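/- Let $p\ge 2$ be an integer and let $\mathcal S^{p-1}$ be the unit sphere of $\mathbb R^p$. Let $\mathcal F$ be the class of functions $f:\mathbb R\to[0,\infty)$ such that (a) $f$ is non-decreasing on $(-\infty,0]$ and strictly increasing on $[0,\infty)$; (b) $f$ is differentiable on $(M,\infty)$ for some $M$; (c) with $\varphi_f:=f'/f$, the function $\kappa\mapsto\kappa\varphi_f(\kappa)$ tends to $\infty$ as $\kappa\to\infty$ and is non-decreasing on $(M',\infty)$ for some $M'$; (d) for all $\xi,\zeta>-1$, $$\int_{-1}^1(1-s)^\xi(1+s)^\zeta\left|\frac{f(\kappa s)}{f(\kappa)}-e^{(s-1)\kappa\varphi_f(\kappa)}\right|ds=o\!\left(\frac1{(\kappa\varphi_f(\kappa))^{\xi+1}}\right)\quad\text{as }\kappa\to\infty.$$ For $\theta\in\mathcal S^{p-1}$, $\kappa>0$ and $f\in\mathcal F$, let $\mathrm{Rot}_p(\theta,\kappa,f)$ be the distribution on $\mathcal S^{p-1}$ whose density with respect to the surface area measure is $$x\mapsto\frac{c_{p,\kappa,f}\,\Gamma(\frac{p-1}2)}{2\pi^{(p-1)/2}}\,f(\kappa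 x'\theta),\qquad c_{p,\kappa,f}:=1\Big/\int_{-1}^1(1-s^2)^{(p-3)/2}f(\kappa s)\,ds,$$ and let $\mathrm P^{(n)}_{\theta,\kappa,f}$ be the hypothesis under which $X_{n1},\dots,X_{nn}$ are independent with common distribution $\mathrm{Rot}_p(\theta,\kappa,f)$. Put $\bar X_n:=\frac1n\sum_{i=1}^nX_{ni}$ and $\hat\theta_n:=\bar X_n/\|\bar X_n\|$. For $\theta_0\in\mathcal S^{p-1}$, the Watson and Wald statistics are $$W_n:=\frac{n(p-1)\,\bar X_n'(I_p-\theta_0\theta_0')\bar X_n}{1-\frac1n\sum_{i=1}^n(X_{ni}'\theta_0)^2},\qquad S_n:=\frac{n(p-1)\,(\bar X_n'\theta_0)^2\,\hat\theta_n'(I_p-\theta_0\theta_0')\hat\theta_n}{1-\frac1n\sum_{i=1}^n(X_{ni}'\theta_0)^2}.$$ **Theorem.** Fix an integer $p\ge2$, $\theta_0\in\mathcal S^{p-1}$ and $f\in\mathcal F$. Let $(\kappa_n)$ be a sequence of positive real numbers that diverges to infinity. Let $(\tau_n)$ be a sequence in $\mathbb R^p$ that converges to $\tau$ and is such that $\theta_n:=\theta_0+\nu_n\tau_n\in\mathcal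 S^{p-1}$ for all $n$, where $\nu_n:=1/\sqrt{n\kappa_n\varphi_f(\kappa_n)}$. (If $\nu_n$ is undefined for finitely many $n$, put $\nu_n:=0$ for these $n$.) Then, as $n\to\infty$: (i) under $\mathrm P^{(n)}_{\theta_0,\kappa_n,f}$, $W_n-S_n\to0$ in probability, and $W_n$ and $S_n$ both converge in distribution to the chi-square distribution $\chi^2_{p-1}$; (ii) under $\mathrm P^{(n)}_{\theta_n,\kappa_n,f}$, $W_n-S_n\to0$ in probability, and $W_n$ and $S_n$ both converge in distribution to the non-central chi-square distribution $\chi^2_{p-1}(\|\tau\|^2)$ with $p-1$ degrees of freedom and non-centrality parameter $\|\tau\|^2$, that is, the distribution of $\sum_{j=1}^{p-1}Z_j^2$ for independent normal variables $Z_j$ with unit variance and means $\mu_j$ satisfying $\sum_j\mu_j^2=\|\tau\|^2$. -/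

import Mathlib

open Filter MeasureTheory ProbabilityTheory Set Asymptotics
open scoped Topology

noncomputable section

namespace HighConc

/-- The unit sphere `S^{p-1}` of `ℝ^p`. -/
abbrev Sph (p : ℕ) : Type := Metric.sphere (0 : EuclideanSpace ℝ (Fin p)) 1

/-- `φ_f = f' / f`. -/
def phi (f : ℝ → ℝ) (z : ℝ) : ℝ := deriv f z / f z

/-- The class `𝓕` of angular functions. In the last condition the usual form is
`exp (log f(κ s) - log f(κ))`, that is, `f(κ s) / f(κ)` (and is `0` where `f(κ s) = 0`). -/
structure AngularClass (f : ℝ → ℝ) : Prop where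
  nonneg : ∀ z, 0 ≤ f z
  monotoneOn : MonotoneOn f (Iic 0)
  strictMonoOn : StrictMonoOn f (Ici 0)
  differentiable : ∃ M : ℝ, ∀ z, M < z → DifferentiableAt ℝ f z
  tendsto : Tendsto (fun κ : ℝ => κ * phi f κ) atTop atTop
  eventually_monotone : ∃ M : ℝ, MonotoneOn (fun κ : ℝ => κ * phi f κ) (Ioi M)
  approx : ∀ ξ ζ : ℝ, -1 < ξ → -1 < ζ →
    (fun κ : ℝ => ∫ s in (-1 : ℝ)..1, (1 - s) ^ ξ * (1 + s) ^ ζ *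
        |f (κ * s) / f κ - Real.exp ((s - 1) * (κ * phi f κ))|)
      =o[atTop] (fun κ : ℝ => 1 / (κ * phi f κ) ^ (ξ + 1))

/-- The normalizing constant `c_{p,κ,f}`. -/
def normConst (p : ℕ) (κ : ℝ) (f : ℝ → ℝ) : ℝ :=
  1 / ∫ s in (-1 : ℝ)..1, (1 - s ^ 2) ^ (((p : ℝ) - 3) / 2) * f (κ * s)

/-- The rotationally symmetric distribution `Rot_p(θ, κ, f)` on the unit sphere, given by its
density with respect to the surface area measure. -/
def rot (p : ℕ) (θ : Sph p) (κ : ℝ) (f : ℝ → ℝ) : Measure (Sph p) :=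
  (volume : Measure (EuclideanSpace ℝ (Fin p))).toSphere.withDensity fun x =>
    ENNReal.ofReal
      (normConst p κ f * Real.Gamma (((p : ℝ) - 1) / 2) / (2 * Real.pi ^ (((p : ℝ) - 1) / 2))
        * f (κ * inner ℝ (x : EuclideanSpace ℝ (Fin p)) (θ : EuclideanSpace ℝ (Fin p))))

/-- The hypothesis `P^{(n)}_{θ,κ,f}`: under `P`, the observations `X 0, …, X (n-1)` are
mutually independent with common distribution `Rot_p(θ, κ, f)`. -/
structure IsRotSample {p n : ℕ} {Ω : Type*} [MeasurableSpace Ω] (P : Measure Ω)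
    (X : Fin n → Ω → Sph p) (θ : Sph p) (κ : ℝ) (f : ℝ → ℝ) : Prop where
  hasLaw : ∀ i, HasLaw (X i) (rot p θ κ f) P
  indep : iIndepFun X P

/-- The sample mean. -/
def sampleMean {p n : ℕ} (x : Fin n → Sph p) : EuclideanSpace ℝ (Fin p) :=
  (n : ℝ)⁻¹ • ∑ i, (x i : EuclideanSpace ℝ (Fin p))

/-- The spherical mean. -/
def sphericalMean {p n : ℕ} (x : Fin n → Sph p) : EuclideanSpace ℝ (Fin p) :=
  ‖sampleMean x‖⁻¹ • sampleMean x

/-- The quadratic form `y' (I_p - θ θ') y`. -/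
def tangentForm {p : ℕ} (θ : Sph p) (y : EuclideanSpace ℝ (Fin p)) : ℝ :=
  inner ℝ y (y - inner ℝ (θ : EuclideanSpace ℝ (Fin p)) y • (θ : EuclideanSpace ℝ (Fin p)))

/-- The common denominator `1 - (1/n) ∑ (X_i' θ₀)²`. -/
def testDenom {p n : ℕ} (θ₀ : Sph p) (x : Fin n → Sph p) : ℝ :=
  1 - (n : ℝ)⁻¹ * ∑ i, (inner ℝ (x i : EuclideanSpace ℝ (Fin p))
    (θ₀ : EuclideanSpace ℝ (Fin p))) ^ 2

/-- The Watson test statistic `W_n`. -/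
def watson {p n : ℕ} (θ₀ : Sph p) (x : Fin n → Sph p) : ℝ :=
  n * ((p : ℝ) - 1) * tangentForm θ₀ (sampleMean x) / testDenom θ₀ x

/-- The Wald test statistic `S_n`. -/
def wald {p n : ℕ} (θ₀ : Sph p) (x : Fin n → Sph p) : ℝ :=
  n * ((p : ℝ) - 1) * (inner ℝ (sampleMean x) (θ₀ : EuclideanSpace ℝ (Fin p))) ^ 2
    * tangentForm θ₀ (sphericalMean x) / testDenom θ₀ x

/-- The rate `ν_n = 1 / √(n κ_n φ_f(κ_n))`. -/
def rate (f : ℝ → ℝ) (κ : ℕ → ℝ) (n : ℕ) : ℝ := 1 / √(n * κ n * phi f (κ n))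

/-- The non-central chi-square distribution with `k ≥ 1` degrees of freedom and non-centrality
parameter `c ≥ 0`: the law of `∑ Z_i²` for independent normal variables `Z_i` with unit variance
and means `√c, 0, …, 0`. -/
def noncentralChiSq (k : ℕ) (c : ℝ) : Measure ℝ :=
  (Measure.pi fun i : Fin k => gaussianReal (if (i : ℕ) = 0 then √c else 0) 1).map
    fun z => ∑ i, z i ^ 2

/-- The (central) chi-square distribution with `k` degrees of freedom. -/
def chiSq (k : ℕ) : Measure ℝ :=
  (Measure.pi fun _ : Fin k => gaussianReal 0 1).map fun z => ∑ i, z i ^ 2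

instance (k : ℕ) (c : ℝ) : IsProbabilityMeasure (noncentralChiSq k c) :=
  Measure.isProbabilityMeasure_map (Measurable.aemeasurable (by fun_prop))

instance (k : ℕ) : IsProbabilityMeasure (chiSq k) :=
  Measure.isProbabilityMeasure_map (Measurable.aemeasurable (by fun_prop))

end HighConc

end

-- Write `a = κ φ_f(κ)`, `u = 1 - x'θ` and `p = k + 2`. Under the rotationally symmetric law the
-- cosine `s = x'θ` has density proportional to `(1 - s²)^((p-3)/2) f(κ s)`. Condition (d) replaces
-- `f(κ s) / f(κ)` by `exp ((s - 1) a)` at the precision needed, so `a u` has asymptotically the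
-- moments of a Gamma variable of shape `(p-1)/2` (`tendsto_moment`). Symmetry around `θ` reduces
-- the first two moments of `x` to those of the cosine. In particular `a E[1 - (x'θ)²] → p - 1`, so
-- each of the `p - 1` tangential coordinates has variance about `1/a`.
--
-- The rate `ν_n = 1/√(n a_n)` is therefore the scale of the tangential fluctuations of the sample
-- mean. After multiplication by `√(n a_n)`, the location `θ_n` contributes a tangential drift `τ_n`
-- and the centred observations a standard Gaussian limit. A Lyapunov-type central limit theorem,
-- proved by characteristic functions, gives this (`tendstoInDistribution_scaledCoords`). Its
-- squared norm `U_n` has the non-central chi-square limit.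
--
-- The Watson statistic is exactly `(p - 1) / (a_n D_n) * U_n`, with `D_n` the common denominator,
-- and `a_n D_n → p - 1` in probability. The Wald statistic is exactly the Watson statistic times
-- `(x̄'θ₀)² / ‖x̄‖²`, which tends to one in probability because the sample mean concentrates at
-- `θ₀`. Slutsky's theorem then concludes. The alternatives are treated directly, without
-- contiguity, and the null hypothesis is the case `τ = 0`.

namespace HighConc

-- Surface measure of the sphere and its projection on an axis

/-- Integration in polar coordinates for nonnegative functions. -/
lemma lintegral_eq_lintegral_toSphere {E : Type*} [NormedAddCommGroup E] [NormedSpace ℝ E]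
    [MeasurableSpace E] [Nontrivial E] (μ : Measure E) [FiniteDimensional ℝ E] [BorelSpace E]
    [μ.IsAddHaarMeasure] (H : E → ENNReal) (hH : Measurable H) :
    ∫⁻ x, H x ∂μ = ∫⁻ y : Metric.sphere (0 : E) 1, ∫⁻ r : Ioi (0 : ℝ), H ((r : ℝ) • (y : E))
      ∂(Measure.volumeIoiPow (Module.finrank ℝ E - 1)) ∂μ.toSphere := by
  have h1 : ∫⁻ x, H x ∂μ = ∫⁻ x : ({(0)}ᶜ : Set E), H x.1 ∂(μ.comap (↑)) := by
    rw [lintegral_subtype_comap (measurableSet_singleton _).compl fun x ↦ H x,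
      restrict_compl_singleton]
  have h2 := μ.measurePreserving_homeomorphUnitSphereProd.lintegral_comp_emb
        (Homeomorph.measurableEmbedding _)
        (fun q : Metric.sphere (0 : E) 1 × Ioi (0 : ℝ) => H ((q.2 : ℝ) • (q.1 : E)))
  have h3 : ∀ x : ({(0)}ᶜ : Set E), H ((((homeomorphUnitSphereProd E x).2 : Ioi (0 : ℝ)) : ℝ) •
      ((homeomorphUnitSphereProd E x).1 : E)) = H x.1 := by
    intro x
    rw [← homeomorphUnitSphereProd_symm_apply_coe, Homeomorph.symm_apply_apply]
  simp only [h3] at h2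
  rw [h1, h2, lintegral_prod]
  exact (hH.comp (by fun_prop)).aemeasurable

lemma lintegral_volumeIoiPow (n : ℕ) (H : ℝ → ENNReal) (hH : Measurable H) :
    ∫⁻ r : Ioi (0 : ℝ), H r ∂(Measure.volumeIoiPow n)
      = ∫⁻ r in Ioi (0 : ℝ), ENNReal.ofReal (r ^ n) * H r := by
  rw [Measure.volumeIoiPow, lintegral_withDensity_eq_lintegral_mul _ (by fun_prop) (by fun_prop)]
  exact lintegral_subtype_comap measurableSet_Ioi (fun r => ENNReal.ofReal (r ^ n) * H r)

/-- The action of a linear isometry on the unit sphere. -/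
noncomputable def sphMap {p : ℕ} (T : EuclideanSpace ℝ (Fin p) ≃ₗᵢ[ℝ] EuclideanSpace ℝ (Fin p)) (x : Sph p) :
    Sph p :=
  ⟨T x, by simp⟩

-- The surface measure of a set is read off the volume of the cone over it; linear isometries
-- commute with forming cones and preserve volume.
open scoped Pointwise in
lemma measurePreserving_sphMap {p : ℕ}
    (T : EuclideanSpace ℝ (Fin p) ≃ₗᵢ[ℝ] EuclideanSpace ℝ (Fin p)) :
    MeasurePreserving (sphMap T) (volume : Measure (EuclideanSpace ℝ (Fin p))).toSphere
      (volume : Measure (EuclideanSpace ℝ (Fin p))).toSphere := by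
  have hm : Measurable (sphMap T) := by
    refine Measurable.subtype_mk ?_
    exact T.continuous.measurable.comp measurable_subtype_coe
  refine ⟨hm, ?_⟩
  ext s hs
  rw [Measure.map_apply hm hs, Measure.toSphere_apply' _ (hm hs), Measure.toSphere_apply' _ hs]
  congr 1
  have : Ioo (0 : ℝ) 1 • ((↑) '' (sphMap T ⁻¹' s) : Set (EuclideanSpace ℝ (Fin p)))
      = T ⁻¹' (Ioo (0 : ℝ) 1 • ((↑) '' s : Set (EuclideanSpace ℝ (Fin p)))) := by
    ext x
    simp only [Set.mem_smul, mem_image, mem_preimage]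
    constructor
    · rintro ⟨r, hr, _, ⟨y, hy, rfl⟩, rfl⟩
      exact ⟨r, hr, T y, ⟨sphMap T y, hy, rfl⟩, by simp⟩
    · rintro ⟨r, hr, _, ⟨y, hy, rfl⟩, h⟩
      refine ⟨r, hr, T.symm y, ⟨sphMap T.symm y, ?_, rfl⟩, ?_⟩
      · convert hy
        ext1
        simp [sphMap]
      · apply T.injective
        simpa using h
  rw [this]
  exact T.measurePreserving.measure_preimage_emb T.toHomeomorph.measurableEmbedding _

/-- Splitting off the coordinate along the first vector of an orthonormal basis. -/
lemma lintegral_inner_norm {k : ℕ} (θ : Sph (k + 2)) (F : ℝ × ℝ → ENNReal) (hF : Measurable F) :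
    ∫⁻ x : EuclideanSpace ℝ (Fin (k + 2)),
        F (inner ℝ x (θ : EuclideanSpace ℝ (Fin (k + 2))), ‖x‖)
      = ∫⁻ t : ℝ, ∫⁻ y : EuclideanSpace ℝ (Fin (k + 1)), F (t, √(t ^ 2 + ‖y‖ ^ 2)) := by
  obtain ⟨b, hb⟩ := Orthonormal.exists_orthonormalBasis_extension_of_card_eq (𝕜 := ℝ)
    (E := EuclideanSpace ℝ (Fin (k + 2))) (ι := Fin (k + 2)) (by simp)
    (v := fun _ => (θ : EuclideanSpace ℝ (Fin (k + 2)))) (s := {0}) (by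
      constructor
      · rintro ⟨i, hi⟩; simp
      · rintro ⟨i, hi⟩ ⟨j, hj⟩ h
        simp only [mem_singleton_iff] at hi hj
        exact absurd (Subtype.ext (hi.trans hj.symm)) h)
  have hb0 : b 0 = θ := hb 0 rfl
  have e1 := b.measurePreserving_repr
  have e2 := PiLp.volume_preserving_ofLp (Fin (k + 2))
  have e3 := volume_preserving_piFinSuccAbove (fun _ : Fin (k + 2) => ℝ) 0
  have e4 := (MeasurePreserving.id (volume : Measure ℝ)).prod
    (PiLp.volume_preserving_toLp (Fin (k + 1)))
  have e := e4.comp (e3.comp (e2.comp e1))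
  have key := e.lintegral_comp (f := fun q : ℝ × EuclideanSpace ℝ (Fin (k + 1)) =>
    F (q.1, √(q.1 ^ 2 + ‖q.2‖ ^ 2))) (by fun_prop)
  rw [lintegral_prod _ (by fun_prop)] at key
  rw [← key]
  refine lintegral_congr fun x => ?_
  have h1 : b.repr x 0 = inner ℝ x (θ : EuclideanSpace ℝ (Fin (k + 2))) := by
    rw [b.repr_apply_apply, hb0, real_inner_comm]
  have h2 : ‖x‖ = √((b.repr x 0) ^ 2 + ∑ j : Fin (k + 1), (b.repr x j.succ) ^ 2) := by
    rw [← Fin.sum_univ_succ (fun j => (b.repr x j) ^ 2), ← b.repr.norm_map x,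
      EuclideanSpace.norm_eq]
    simp
  simp only [Function.comp_apply, MeasurableEquiv.piFinSuccAbove_apply, Fin.insertNthEquiv,
    EuclideanSpace.norm_sq_eq]
  rw [h2, ← h1]
  simp [Fin.tail]

/-- Planar polar coordinates `t = r cos φ`, `ρ = r sin φ` turn `ρ^k dt dρ` into `r^(k+1) sin^k φ dr
dφ`. The integrand is extended by zero to `ρ ≤ 0`, which restricts the angle to `(0, π)`. -/
lemma lintegral_polar_half (k : ℕ) (g h : ℝ → ENNReal) (hg : Measurable g) (hh : Measurable h) :
    ∫⁻ t : ℝ, ∫⁻ ρ in Ioi (0 : ℝ), ENNReal.ofReal (ρ ^ k) *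
        (g (t / √(t ^ 2 + ρ ^ 2)) * h √(t ^ 2 + ρ ^ 2))
      = (∫⁻ r in Ioi (0 : ℝ), ENNReal.ofReal (r ^ (k + 1)) * h r) *
        ∫⁻ φ in Ioo (0 : ℝ) Real.pi, g (Real.cos φ) * ENNReal.ofReal (Real.sin φ ^ k) := by
  set G : ℝ × ℝ → ENNReal := fun q => (Ioi (0 : ℝ)).indicator (fun ρ => ENNReal.ofReal (ρ ^ k) *
        (g (q.1 / √(q.1 ^ 2 + ρ ^ 2)) * h √(q.1 ^ 2 + ρ ^ 2))) q.2 with hG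
  have hGm : Measurable G := by
    have : G = (univ ×ˢ Ioi (0 : ℝ)).indicator (fun q : ℝ × ℝ => ENNReal.ofReal (q.2 ^ k) *
        (g (q.1 / √(q.1 ^ 2 + q.2 ^ 2)) * h √(q.1 ^ 2 + q.2 ^ 2))) := by
      ext q
      simp [hG, indicator]
    rw [this]
    exact Measurable.indicator (by fun_prop) (MeasurableSet.univ.prod measurableSet_Ioi)
  have h1 := lintegral_comp_polarCoord_symm G
  have h2 : ∫⁻ q, G q = ∫⁻ t : ℝ, ∫⁻ ρ in Ioi (0 : ℝ), ENNReal.ofReal (ρ ^ k) *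
        (g (t / √(t ^ 2 + ρ ^ 2)) * h √(t ^ 2 + ρ ^ 2)) := by
    rw [Measure.volume_eq_prod, lintegral_prod _ hGm.aemeasurable]
    refine lintegral_congr fun t => ?_
    rw [← lintegral_indicator measurableSet_Ioi]
  rw [← h2, ← h1, polarCoord_target, Measure.volume_eq_prod, ← Measure.prod_restrict]
  have h3 : ∀ q : ℝ × ℝ, q ∈ Ioi (0 : ℝ) ×ˢ Ioo (-Real.pi) Real.pi →
      ENNReal.ofReal q.1 • G (polarCoord.symm q) = (ENNReal.ofReal (q.1 ^ (k + 1)) * h q.1) *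
        (Ioo (0 : ℝ) Real.pi).indicator
          (fun φ => g (Real.cos φ) * ENNReal.ofReal (Real.sin φ ^ k)) q.2 := by
    rintro ⟨r, φ⟩ ⟨hr, hφ⟩
    simp only [mem_Ioi] at hr
    have e1 : √((r * Real.cos φ) ^ 2 + (r * Real.sin φ) ^ 2) = r := by
      rw [mul_pow, mul_pow, ← mul_add, Real.cos_sq_add_sin_sq, mul_one, Real.sqrt_sq hr.le]
    have e2 : r * Real.cos φ / r = Real.cos φ := by field_simp
    by_cases h0 : 0 < φ
    · have hs : 0 < Real.sin φ := Real.sin_pos_of_pos_of_lt_pi h0 hφ.2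
      have m1 : r * Real.sin φ ∈ Ioi (0 : ℝ) := mul_pos hr hs
      have m2 : φ ∈ Ioo (0 : ℝ) Real.pi := ⟨h0, hφ.2⟩
      simp only [hG, polarCoord_symm_apply, indicator_of_mem m1, indicator_of_mem m2, e1, e2,
        smul_eq_mul]
      rw [mul_pow, ENNReal.ofReal_mul (by positivity), pow_succ, ENNReal.ofReal_mul (by positivity)]
      ring
    · have m2 : φ ∉ Ioo (0 : ℝ) Real.pi := fun h => h0 h.1
      have hs : Real.sin φ ≤ 0 :=
        Real.sin_nonpos_of_nonpos_of_neg_pi_le (not_lt.1 h0) hφ.1.le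
      have m1 : r * Real.sin φ ∉ Ioi (0 : ℝ) := by
        simp only [mem_Ioi, not_lt]
        exact mul_nonpos_of_nonneg_of_nonpos hr.le hs
      simp only [hG, polarCoord_symm_apply, indicator_of_notMem m1, indicator_of_notMem m2,
        smul_zero, mul_zero]
  rw [Measure.prod_restrict, setLIntegral_congr_fun (measurableSet_Ioi.prod measurableSet_Ioo) h3,
    ← Measure.prod_restrict,
    lintegral_prod_mul (f := fun r => ENNReal.ofReal (r ^ (k + 1)) * h r) (by fun_prop)
      (Measurable.aemeasurable (Measurable.indicator (by fun_prop) measurableSet_Ioo))]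
  congr 1
  rw [lintegral_indicator measurableSet_Ioo, Measure.restrict_restrict measurableSet_Ioo]
  congr 2
  refine inter_eq_left.2 (Ioo_subset_Ioo_left (by linarith [Real.pi_pos]))

/-- Substitution `s = cos φ`: the Jacobian absorbs one factor `sin φ`, whence the exponent `(k - 1)
/ 2`. -/
lemma lintegral_cos_mul_sin_pow (k : ℕ) (g : ℝ → ENNReal) :
    ∫⁻ φ in Ioo (0 : ℝ) Real.pi, g (Real.cos φ) * ENNReal.ofReal (Real.sin φ ^ k)
      = ∫⁻ s in Ioo (-1 : ℝ) 1, g s * ENNReal.ofReal ((1 - s ^ 2) ^ (((k : ℝ) - 1) / 2)) := by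
  have himg : Real.cos '' Ioo (0 : ℝ) Real.pi = Ioo (-1 : ℝ) 1 := by
    ext s
    constructor
    · rintro ⟨φ, hφ, rfl⟩
      constructor
      · have := Real.strictAntiOn_cos ⟨hφ.1.le, hφ.2.le⟩ ⟨Real.pi_pos.le, le_rfl⟩ hφ.2
        simpa using this
      · have := Real.strictAntiOn_cos ⟨le_rfl, Real.pi_pos.le⟩ ⟨hφ.1.le, hφ.2.le⟩ hφ.1
        simpa using this
    · rintro ⟨h1, h2⟩
      exact ⟨Real.arccos s, ⟨Real.arccos_pos.2 h2, Real.arccos_lt_pi.2 h1⟩,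
        Real.cos_arccos h1.le h2.le⟩
  rw [← himg, lintegral_image_eq_lintegral_abs_deriv_mul measurableSet_Ioo
    (f' := fun φ => -Real.sin φ) (fun φ _ => (Real.hasDerivAt_cos φ).hasDerivWithinAt)
    (Real.injOn_cos.mono Ioo_subset_Icc_self)]
  refine setLIntegral_congr_fun measurableSet_Ioo fun φ hφ => ?_
  have hs : 0 < Real.sin φ := Real.sin_pos_of_pos_of_lt_pi hφ.1 hφ.2
  rw [← Real.sin_sq, abs_neg, abs_of_pos hs, mul_left_comm, ← ENNReal.ofReal_mul hs.le]
  congr 2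
  rw [← Real.rpow_natCast _ 2, ← Real.rpow_mul hs.le, ← Real.rpow_natCast _ k]
  nth_rewrite 2 [← Real.rpow_one (Real.sin φ)]
  rw [← Real.rpow_add hs]
  congr 1
  push_cast
  ring

/-- The surface measure of the sphere, projected on an axis, has density proportional to
`(1 - s²)^((p-3)/2)`. -/
lemma exists_lintegral_toSphere_inner {k : ℕ} (θ : Sph (k + 2)) :
    ∃ C : ENNReal, ∀ g : ℝ → ENNReal, Measurable g →
      ∫⁻ x : Sph (k + 2), g (inner ℝ (x : EuclideanSpace ℝ (Fin (k + 2)))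
          (θ : EuclideanSpace ℝ (Fin (k + 2))))
        ∂(volume : Measure (EuclideanSpace ℝ (Fin (k + 2)))).toSphere
      = C * ∫⁻ s in Ioo (-1 : ℝ) 1, g s * ENNReal.ofReal ((1 - s ^ 2) ^ (((k : ℝ) - 1) / 2)) := by
  -- Integrate `g (cosine) * h (norm)` over the whole space in two ways: spherically, and after
  -- splitting off the axis `θ`. The cut-off `h` makes the radial integral `c`, common to both
  -- computations, finite and nonzero, so that it cancels.
  set h : ℝ → ENNReal := (Iio (1 : ℝ)).indicator 1 with hh
  have hhm : Measurable h := measurable_one.indicator measurableSet_Iio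
  set c : ENNReal := ∫⁻ r in Ioi (0 : ℝ), ENNReal.ofReal (r ^ (k + 1)) * h r with hc
  set S : ENNReal := (volume : Measure (EuclideanSpace ℝ (Fin (k + 1)))).toSphere univ
  have hcv : c = ENNReal.ofReal (1 / (k + 2)) := by
    rw [hc, ← lintegral_volumeIoiPow (k + 1) h hhm]
    have : (fun r : Ioi (0 : ℝ) => h r) = (Iio (⟨1, mem_Ioi.2 one_pos⟩ : Ioi (0 : ℝ))).indicator 1 := by
      ext r
      simp [hh, indicator, ← Subtype.coe_lt_coe]
    rw [this, lintegral_indicator_one measurableSet_Iio, Measure.volumeIoiPow_apply_Iio]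
    congr 1
    push_cast
    simp
    ring
  have hc0 : c ≠ 0 := by
    rw [hcv]; simp only [ne_eq, ENNReal.ofReal_eq_zero, not_le]; positivity
  have hct : c ≠ ⊤ := by rw [hcv]; exact ENNReal.ofReal_ne_top
  refine ⟨S, fun g hg => ?_⟩
  have key := lintegral_inner_norm θ (fun q => g (q.1 / q.2) * h q.2) (by fun_prop)
  rw [lintegral_eq_lintegral_toSphere _ _ (by fun_prop)] at key
  have l1 : ∀ y : Sph (k + 2), ∫⁻ r : Ioi (0 : ℝ),
      g (inner ℝ ((r : ℝ) • (y : EuclideanSpace ℝ (Fin (k + 2))))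
        (θ : EuclideanSpace ℝ (Fin (k + 2))) / ‖(r : ℝ) • (y : EuclideanSpace ℝ (Fin (k + 2)))‖)
        * h ‖(r : ℝ) • (y : EuclideanSpace ℝ (Fin (k + 2)))‖
        ∂(Measure.volumeIoiPow (Module.finrank ℝ (EuclideanSpace ℝ (Fin (k + 2))) - 1))
      = g (inner ℝ (y : EuclideanSpace ℝ (Fin (k + 2))) (θ : EuclideanSpace ℝ (Fin (k + 2)))) * c := by
    intro y
    have : ∀ r : Ioi (0 : ℝ), g (inner ℝ ((r : ℝ) • (y : EuclideanSpace ℝ (Fin (k + 2))))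
        (θ : EuclideanSpace ℝ (Fin (k + 2))) / ‖(r : ℝ) • (y : EuclideanSpace ℝ (Fin (k + 2)))‖)
        * h ‖(r : ℝ) • (y : EuclideanSpace ℝ (Fin (k + 2)))‖
        = g (inner ℝ (y : EuclideanSpace ℝ (Fin (k + 2))) (θ : EuclideanSpace ℝ (Fin (k + 2))))
          * h r := by
      rintro ⟨r, hr⟩
      simp only [mem_Ioi] at hr
      have hn : ‖r • (y : EuclideanSpace ℝ (Fin (k + 2)))‖ = r := by
        rw [norm_smul, norm_eq_of_mem_sphere, mul_one, Real.norm_of_nonneg hr.le]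
      rw [hn, real_inner_smul_left, mul_div_cancel_left₀ _ hr.ne']
    simp_rw [this]
    rw [lintegral_const_mul _ (by fun_prop), finrank_euclideanSpace_fin,
      lintegral_volumeIoiPow _ h hhm, hc]
    rfl
  have l2 : ∀ t : ℝ, ∫⁻ y : EuclideanSpace ℝ (Fin (k + 1)), g (t / √(t ^ 2 + ‖y‖ ^ 2)) *
      h √(t ^ 2 + ‖y‖ ^ 2) = S * ∫⁻ ρ in Ioi (0 : ℝ), ENNReal.ofReal (ρ ^ k) *
        (g (t / √(t ^ 2 + ρ ^ 2)) * h √(t ^ 2 + ρ ^ 2)) := by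
    intro t
    rw [lintegral_eq_lintegral_toSphere _ _ (by fun_prop)]
    have : ∀ (y : Metric.sphere (0 : EuclideanSpace ℝ (Fin (k + 1))) 1) (r : Ioi (0 : ℝ)),
        ‖(r : ℝ) • (y : EuclideanSpace ℝ (Fin (k + 1)))‖ = r := by
      rintro y ⟨r, hr⟩
      simp only [mem_Ioi] at hr
      rw [norm_smul, norm_eq_of_mem_sphere, mul_one, Real.norm_of_nonneg hr.le]
    simp_rw [this]
    rw [lintegral_const, finrank_euclideanSpace_fin, lintegral_volumeIoiPow _
      (fun ρ => g (t / √(t ^ 2 + ρ ^ 2)) * h √(t ^ 2 + ρ ^ 2)) (by fun_prop), mul_comm]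
    rfl
  simp_rw [l1, l2] at key
  rw [lintegral_mul_const _ (by fun_prop), lintegral_const_mul _ ?_,
    lintegral_polar_half k g h hg hhm, lintegral_cos_mul_sin_pow, ← hc] at key
  · rw [mul_comm _ c, mul_left_comm] at key
    exact (ENNReal.mul_right_inj hc0 hct).1 key
  · exact Measurable.lintegral_prod_right'
      (f := fun q : ℝ × ℝ => ENNReal.ofReal (q.2 ^ k) *
        (g (q.1 / √(q.1 ^ 2 + q.2 ^ 2)) * h √(q.1 ^ 2 + q.2 ^ 2))) (by fun_prop)

end HighConc

-- Rotationally symmetric laws: the cosine and the first two moments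

namespace HighConc

lemma AngularClass.monotone {f : ℝ → ℝ} (hf : AngularClass f) : Monotone f :=
  hf.monotoneOn.Iic_union_Ici hf.strictMonoOn.monotoneOn

lemma AngularClass.pos {f : ℝ → ℝ} (hf : AngularClass f) {z : ℝ} (hz : 0 < z) : 0 < f z :=
  (hf.nonneg 0).trans_lt (hf.strictMonoOn self_mem_Ici hz.le hz)

lemma inner_sph_le_one {p : ℕ} (x y : Sph p) :
    inner ℝ (x : EuclideanSpace ℝ (Fin p)) (y : EuclideanSpace ℝ (Fin p)) ≤ 1 := by
  simpa using real_inner_le_norm (x : EuclideanSpace ℝ (Fin p)) y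

lemma neg_one_le_inner_sph {p : ℕ} (x y : Sph p) :
    -1 ≤ inner ℝ (x : EuclideanSpace ℝ (Fin p)) (y : EuclideanSpace ℝ (Fin p)) := by
  have := (abs_le.1 (abs_real_inner_le_norm (x : EuclideanSpace ℝ (Fin p)) y)).1
  simpa using this

/-- The constant may stay unspecified: for a probability law it is determined by the case `g = 1`,
so neither sphere areas nor `normConst` need be evaluated. -/
lemma exists_lintegral_rot {k : ℕ} (θ : Sph (k + 2)) (κ : ℝ) {f : ℝ → ℝ} (hf : AngularClass f) :
    ∃ C : ENNReal, ∀ g : ℝ → ENNReal, Measurable g →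
      ∫⁻ x, g (inner ℝ (x : EuclideanSpace ℝ (Fin (k + 2)))
          (θ : EuclideanSpace ℝ (Fin (k + 2)))) ∂rot (k + 2) θ κ f
      = C * ∫⁻ s in Ioo (-1 : ℝ) 1,
          g s * ENNReal.ofReal ((1 - s ^ 2) ^ (((k : ℝ) - 1) / 2) * f (κ * s)) := by
  obtain ⟨C, hC⟩ := exists_lintegral_toSphere_inner θ
  have hfm : Measurable f := hf.monotone.measurable
  set A : ℝ := normConst (k + 2) κ f * Real.Gamma ((((k + 2 : ℕ) : ℝ) - 1) / 2) /
    (2 * Real.pi ^ ((((k + 2 : ℕ) : ℝ) - 1) / 2)) with hA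
  refine ⟨ENNReal.ofReal A * C, fun g hg => ?_⟩
  rw [rot, lintegral_withDensity_eq_lintegral_mul _ (by fun_prop) (by fun_prop)]
  simp only [Pi.mul_apply, ← hA, ENNReal.ofReal_mul' (hf.nonneg _), mul_assoc]
  rw [lintegral_const_mul _ (by fun_prop)]
  congr 1
  rw [hC (fun s => ENNReal.ofReal (f (κ * s)) * g s) (by fun_prop)]
  congr 1
  refine lintegral_congr fun s => ?_
  ring

/-- Under a rotationally symmetric law, the expectation of a function of the cosine `x'θ`. -/
lemma integral_rot_comp_inner {k : ℕ} (θ : Sph (k + 2)) (κ : ℝ) {f : ℝ → ℝ}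
    (hf : AngularClass f) [IsProbabilityMeasure (rot (k + 2) θ κ f)] (g : ℝ → ℝ)
    (hg : Measurable g) (hg0 : ∀ s ∈ Icc (-1 : ℝ) 1, 0 ≤ g s) :
    ∫ x, g (inner ℝ (x : EuclideanSpace ℝ (Fin (k + 2)))
          (θ : EuclideanSpace ℝ (Fin (k + 2)))) ∂rot (k + 2) θ κ f
      = (∫ s in Ioo (-1 : ℝ) 1, g s * ((1 - s ^ 2) ^ (((k : ℝ) - 1) / 2) * f (κ * s))) /
        ∫ s in Ioo (-1 : ℝ) 1, (1 - s ^ 2) ^ (((k : ℝ) - 1) / 2) * f (κ * s) := by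
  obtain ⟨C, hC⟩ := exists_lintegral_rot θ κ hf
  have hfm : Measurable f := hf.monotone.measurable
  have hw : ∀ s ∈ Ioo (-1 : ℝ) 1, 0 ≤ (1 - s ^ 2) ^ (((k : ℝ) - 1) / 2) * f (κ * s) := by
    intro s hs
    refine mul_nonneg (Real.rpow_nonneg ?_ _) (hf.nonneg _)
    nlinarith [hs.1, hs.2]
  -- Total mass one identifies `C` as the reciprocal of the denominator, and rules out the values
  -- zero and infinity for the latter.
  have hone := hC 1 measurable_one
  simp only [Pi.one_apply, lintegral_const, measure_univ, one_mul] at hone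
  have h1 : ∫ s in Ioo (-1 : ℝ) 1, (1 - s ^ 2) ^ (((k : ℝ) - 1) / 2) * f (κ * s)
      = (∫⁻ s in Ioo (-1 : ℝ) 1,
          ENNReal.ofReal ((1 - s ^ 2) ^ (((k : ℝ) - 1) / 2) * f (κ * s))).toReal := by
    rw [integral_eq_lintegral_of_nonneg_ae]
    · filter_upwards [ae_restrict_mem measurableSet_Ioo] with s hs using hw s hs
    · exact Measurable.aestronglyMeasurable (by fun_prop)
  have h2 : ∫ s in Ioo (-1 : ℝ) 1, g s * ((1 - s ^ 2) ^ (((k : ℝ) - 1) / 2) * f (κ * s))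
      = (∫⁻ s in Ioo (-1 : ℝ) 1, ENNReal.ofReal (g s) *
          ENNReal.ofReal ((1 - s ^ 2) ^ (((k : ℝ) - 1) / 2) * f (κ * s))).toReal := by
    rw [integral_eq_lintegral_of_nonneg_ae]
    · congr 1
      refine setLIntegral_congr_fun measurableSet_Ioo fun s hs => ?_
      exact ENNReal.ofReal_mul (hg0 s ⟨hs.1.le, hs.2.le⟩)
    · filter_upwards [ae_restrict_mem measurableSet_Ioo] with s hs using
        mul_nonneg (hg0 s ⟨hs.1.le, hs.2.le⟩) (hw s hs)
    · exact Measurable.aestronglyMeasurable (by fun_prop)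
  rw [integral_eq_lintegral_of_nonneg_ae]
  · rw [hC (fun s => ENNReal.ofReal (g s)) (by fun_prop), h1, h2, ENNReal.toReal_mul]
    have := congrArg ENNReal.toReal hone
    rw [ENNReal.toReal_mul, ENNReal.toReal_one] at this
    rw [eq_div_iff (right_ne_zero_of_mul (this ▸ one_ne_zero))]
    linear_combination (-(∫⁻ s in Ioo (-1 : ℝ) 1, ENNReal.ofReal (g s) *
          ENNReal.ofReal ((1 - s ^ 2) ^ (((k : ℝ) - 1) / 2) * f (κ * s))).toReal) * this
  · exact ae_of_all _ fun x => hg0 _ ⟨neg_one_le_inner_sph _ _, inner_sph_le_one _ _⟩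
  · exact Measurable.aestronglyMeasurable (by fun_prop)

/-- The moments of `1 - x'θ` as ratios of one-dimensional integrals. -/
lemma integral_rot_one_sub_rpow {k : ℕ} (θ : Sph (k + 2)) (κ : ℝ) {f : ℝ → ℝ}
    (hf : AngularClass f) [IsProbabilityMeasure (rot (k + 2) θ κ f)] (η : ℝ) :
    ∫ x, (1 - inner ℝ (x : EuclideanSpace ℝ (Fin (k + 2)))
          (θ : EuclideanSpace ℝ (Fin (k + 2)))) ^ η ∂rot (k + 2) θ κ f
      = (∫ s in (-1 : ℝ)..1, (1 - s) ^ (((k : ℝ) - 1) / 2 + η) *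
          (1 + s) ^ (((k : ℝ) - 1) / 2) * f (κ * s)) /
        ∫ s in (-1 : ℝ)..1, (1 - s) ^ (((k : ℝ) - 1) / 2) *
          (1 + s) ^ (((k : ℝ) - 1) / 2) * f (κ * s) := by
  rw [integral_rot_comp_inner θ κ hf (fun s => (1 - s) ^ η) (by fun_prop)
    fun s hs => Real.rpow_nonneg (by linarith [hs.2]) _]
  have hle : (-1 : ℝ) ≤ 1 := by norm_num
  rw [intervalIntegral.integral_of_le hle, intervalIntegral.integral_of_le hle,
    integral_Ioc_eq_integral_Ioo, integral_Ioc_eq_integral_Ioo]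
  have hsplit : ∀ s ∈ Ioo (-1 : ℝ) 1, (1 - s ^ 2) ^ (((k : ℝ) - 1) / 2)
      = (1 - s) ^ (((k : ℝ) - 1) / 2) * (1 + s) ^ (((k : ℝ) - 1) / 2) := by
    intro s hs
    rw [← Real.mul_rpow (by linarith [hs.2]) (by linarith [hs.1])]
    ring_nf
  congr 1
  · refine setIntegral_congr_fun measurableSet_Ioo fun s hs => ?_
    rw [hsplit s hs, Real.rpow_add (by linarith [hs.2])]
    ring
  · refine setIntegral_congr_fun measurableSet_Ioo fun s hs => ?_
    rw [hsplit s hs]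

lemma inner_apply_isometry_eq {p : ℕ}
    (T : EuclideanSpace ℝ (Fin p) ≃ₗᵢ[ℝ] EuclideanSpace ℝ (Fin p))
    {v w : EuclideanSpace ℝ (Fin p)} (h : T v = w) (x : EuclideanSpace ℝ (Fin p)) :
    inner ℝ (T x) w = inner ℝ x v := by
  rw [← h, T.inner_map_map]

/-- The density depends on `x` only through `x'θ`, which an isometry fixing `θ` leaves unchanged. -/
lemma measurePreserving_sphMap_rot {p : ℕ} (θ : Sph p) (κ : ℝ) {f : ℝ → ℝ} (hf : AngularClass f)
    (T : EuclideanSpace ℝ (Fin p) ≃ₗᵢ[ℝ] EuclideanSpace ℝ (Fin p))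
    (hT : T (θ : EuclideanSpace ℝ (Fin p)) = θ) :
    MeasurePreserving (sphMap T) (rot p θ κ f) (rot p θ κ f) := by
  have hm := (measurePreserving_sphMap T).measurable
  have hfm : Measurable f := hf.monotone.measurable
  refine ⟨hm, ?_⟩
  ext s hs
  rw [Measure.map_apply hm hs, rot, withDensity_apply _ hs, withDensity_apply _ (hm hs),
    ← (measurePreserving_sphMap T).setLIntegral_comp_preimage hs (by fun_prop)]
  refine lintegral_congr fun x => ?_
  have : inner ℝ ((sphMap T x : Sph p) : EuclideanSpace ℝ (Fin p)) (θ : EuclideanSpace ℝ (Fin p))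
      = inner ℝ (x : EuclideanSpace ℝ (Fin p)) (θ : EuclideanSpace ℝ (Fin p)) :=
    inner_apply_isometry_eq T hT _
  rw [this]

lemma integral_rot_comp_isometry {p : ℕ} (θ : Sph p) (κ : ℝ) {f : ℝ → ℝ} (hf : AngularClass f)
    (T : EuclideanSpace ℝ (Fin p) ≃ₗᵢ[ℝ] EuclideanSpace ℝ (Fin p))
    (hT : T (θ : EuclideanSpace ℝ (Fin p)) = θ) (g : EuclideanSpace ℝ (Fin p) → ℝ)
    (hg : Measurable g) :
    ∫ x : Sph p, g (T x) ∂rot p θ κ f = ∫ x : Sph p, g x ∂rot p θ κ f := by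
  have h := measurePreserving_sphMap_rot θ κ hf T hT
  have := integral_map (μ := rot p θ κ f) h.measurable.aemeasurable
    (f := fun x : Sph p => g x)
    (hg.comp measurable_subtype_coe).aestronglyMeasurable
  rw [h.map_eq] at this
  exact this.symm

lemma reflection_eq_self_of_inner_eq_zero {p : ℕ} {θ v : EuclideanSpace ℝ (Fin p)}
    (h : inner ℝ θ v = 0) : (ℝ ∙ v)ᗮ.reflection θ = θ := by
  rw [Submodule.reflection_eq_self_iff, Submodule.mem_orthogonal_singleton_iff_inner_left]
  exact h

/-- The reflection in the hyperplane orthogonal to `v` fixes `θ` and sends `v` to `-v`, so the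
integral equals its own negative. -/
lemma integral_rot_mul_inner_eq_zero {p : ℕ} (θ : Sph p) (κ : ℝ) {f : ℝ → ℝ}
    (hf : AngularClass f) {v : EuclideanSpace ℝ (Fin p)}
    (hv : inner ℝ (θ : EuclideanSpace ℝ (Fin p)) v = 0) (h : ℝ → ℝ) (hh : Measurable h) :
    ∫ x : Sph p, h (inner ℝ (x : EuclideanSpace ℝ (Fin p)) (θ : EuclideanSpace ℝ (Fin p))) *
      inner ℝ (x : EuclideanSpace ℝ (Fin p)) v ∂rot p θ κ f = 0 := by
  have hT := reflection_eq_self_of_inner_eq_zero hv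
  have hv' : (ℝ ∙ v)ᗮ.reflection (-v) = v := by
    rw [map_neg, Submodule.reflection_orthogonalComplement_singleton_eq_neg, neg_neg]
  have := integral_rot_comp_isometry θ κ hf _ hT
    (fun x => h (inner ℝ x (θ : EuclideanSpace ℝ (Fin p))) * inner ℝ x v) (by fun_prop)
  simp only [inner_apply_isometry_eq _ hT, inner_apply_isometry_eq _ hv', inner_neg_right,
    mul_neg, integral_neg] at this
  linarith

/-- Vectors of equal norm are exchanged by the reflection along `v - w`, which fixes `θ` when both
are orthogonal to it. -/
lemma integral_rot_inner_sq_congr {p : ℕ} (θ : Sph p) (κ : ℝ) {f : ℝ → ℝ}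
    (hf : AngularClass f) {v w : EuclideanSpace ℝ (Fin p)}
    (hv : inner ℝ (θ : EuclideanSpace ℝ (Fin p)) v = 0)
    (hw : inner ℝ (θ : EuclideanSpace ℝ (Fin p)) w = 0) (hvw : ‖v‖ = ‖w‖) :
    ∫ x : Sph p, inner ℝ (x : EuclideanSpace ℝ (Fin p)) v ^ 2 ∂rot p θ κ f
      = ∫ x : Sph p, inner ℝ (x : EuclideanSpace ℝ (Fin p)) w ^ 2 ∂rot p θ κ f := by
  have hT : (ℝ ∙ (v - w))ᗮ.reflection (θ : EuclideanSpace ℝ (Fin p)) = θ :=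
    reflection_eq_self_of_inner_eq_zero (by rw [inner_sub_right, hv, hw, sub_zero])
  have hvw' := Submodule.reflection_sub hvw
  have := integral_rot_comp_isometry θ κ hf _ hT (fun x => inner ℝ x w ^ 2) (by fun_prop)
  simpa only [inner_apply_isometry_eq _ hvw'] using this

lemma integrable_of_continuous {p : ℕ} {E : Type*} [NormedAddCommGroup E]
    (μ : Measure (Sph p)) [IsFiniteMeasure μ] {g : Sph p → E} (hg : Continuous g) :
    Integrable g μ :=
  hg.integrable_of_hasCompactSupport (HasCompactSupport.of_compactSpace _)

/-- The squared coordinates along an orthonormal basis of the orthogonal complement of `θ` sum to `1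
- (x'θ)²` and all have the same integral; `k + 1` is the dimension of that complement. -/
lemma integral_rot_inner_sq_of_orthogonal {k : ℕ} (θ : Sph (k + 2)) (κ : ℝ) {f : ℝ → ℝ}
    (hf : AngularClass f) [IsProbabilityMeasure (rot (k + 2) θ κ f)]
    {v : EuclideanSpace ℝ (Fin (k + 2))}
    (hv : inner ℝ (θ : EuclideanSpace ℝ (Fin (k + 2))) v = 0) :
    ∫ x : Sph (k + 2), inner ℝ (x : EuclideanSpace ℝ (Fin (k + 2))) v ^ 2 ∂rot (k + 2) θ κ f
      = ‖v‖ ^ 2 * (∫ x : Sph (k + 2), (1 - inner ℝ (x : EuclideanSpace ℝ (Fin (k + 2)))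
          (θ : EuclideanSpace ℝ (Fin (k + 2))) ^ 2) ∂rot (k + 2) θ κ f) / (k + 1) := by
  obtain ⟨b, hb⟩ := Orthonormal.exists_orthonormalBasis_extension_of_card_eq (𝕜 := ℝ)
    (E := EuclideanSpace ℝ (Fin (k + 2))) (ι := Fin (k + 2)) (by simp)
    (v := fun _ => (θ : EuclideanSpace ℝ (Fin (k + 2)))) (s := {0}) (by
      constructor
      · rintro ⟨i, hi⟩; simp
      · rintro ⟨i, hi⟩ ⟨j, hj⟩ h
        simp only [mem_singleton_iff] at hi hj
        exact absurd (Subtype.ext (hi.trans hj.symm)) h)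
  have hb0 : b 0 = θ := hb 0 rfl
  have h1 : ∀ x : Sph (k + 2), ‖v‖ ^ 2 * (1 - inner ℝ (x : EuclideanSpace ℝ (Fin (k + 2)))
      (θ : EuclideanSpace ℝ (Fin (k + 2))) ^ 2) = ∑ j : Fin (k + 1),
      inner ℝ (x : EuclideanSpace ℝ (Fin (k + 2))) (‖v‖ • b j.succ) ^ 2 := by
    intro x
    have h := b.sum_sq_norm_inner_left (x : EuclideanSpace ℝ (Fin (k + 2)))
    rw [Fin.sum_univ_succ, hb0, norm_eq_of_mem_sphere] at h
    simp only [Real.norm_eq_abs, sq_abs, one_pow] at h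
    simp_rw [inner_smul_right, mul_pow, ← Finset.mul_sum]
    linear_combination ‖v‖ ^ 2 * (-h)
  have h2 : ∀ j : Fin (k + 1), ∫ x : Sph (k + 2), inner ℝ (x : EuclideanSpace ℝ (Fin (k + 2)))
      (‖v‖ • b j.succ) ^ 2 ∂rot (k + 2) θ κ f
      = ∫ x : Sph (k + 2), inner ℝ (x : EuclideanSpace ℝ (Fin (k + 2))) v ^ 2
        ∂rot (k + 2) θ κ f := by
    intro j
    refine integral_rot_inner_sq_congr θ κ hf ?_ hv (by simp [norm_smul])
    rw [inner_smul_right, ← hb0, b.inner_eq_zero (Fin.succ_ne_zero j).symm, mul_zero]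
  rw [← integral_const_mul]
  simp_rw [h1]
  rw [integral_finsetSum _ fun j _ => integrable_of_continuous _ (by fun_prop)]
  simp_rw [h2]
  simp only [Finset.sum_const, Finset.card_univ, Fintype.card_fin, nsmul_eq_mul]
  push_cast
  field_simp

lemma integral_rot_inner {k : ℕ} (θ : Sph (k + 2)) (κ : ℝ) {f : ℝ → ℝ}
    (hf : AngularClass f) [IsProbabilityMeasure (rot (k + 2) θ κ f)]
    (w : EuclideanSpace ℝ (Fin (k + 2))) :
    ∫ x : Sph (k + 2), inner ℝ (x : EuclideanSpace ℝ (Fin (k + 2))) w ∂rot (k + 2) θ κ f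
      = inner ℝ (θ : EuclideanSpace ℝ (Fin (k + 2))) w *
        ∫ x : Sph (k + 2), inner ℝ (x : EuclideanSpace ℝ (Fin (k + 2)))
          (θ : EuclideanSpace ℝ (Fin (k + 2))) ∂rot (k + 2) θ κ f := by
  set c : ℝ := inner ℝ (θ : EuclideanSpace ℝ (Fin (k + 2))) w
  have hv : inner ℝ (θ : EuclideanSpace ℝ (Fin (k + 2)))
      (w - c • (θ : EuclideanSpace ℝ (Fin (k + 2)))) = 0 := by
    rw [inner_sub_right, inner_smul_right, real_inner_self_eq_norm_sq, norm_eq_of_mem_sphere]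
    simp [c]
  have h := integral_rot_mul_inner_eq_zero θ κ hf hv 1 measurable_one
  simp only [Pi.one_apply, one_mul, inner_sub_right, inner_smul_right] at h
  rw [integral_sub (integrable_of_continuous _ (by fun_prop))
    (integrable_of_continuous _ (by fun_prop)), integral_const_mul] at h
  linarith

/-- Split `w` into its component along `θ` and an orthogonal part `v`; the cross term vanishes by
symmetry. -/
lemma integral_rot_inner_sq {k : ℕ} (θ : Sph (k + 2)) (κ : ℝ) {f : ℝ → ℝ}
    (hf : AngularClass f) [IsProbabilityMeasure (rot (k + 2) θ κ f)]
    (w : EuclideanSpace ℝ (Fin (k + 2))) :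
    ∫ x : Sph (k + 2), inner ℝ (x : EuclideanSpace ℝ (Fin (k + 2))) w ^ 2 ∂rot (k + 2) θ κ f
      = (‖w‖ ^ 2 - inner ℝ (θ : EuclideanSpace ℝ (Fin (k + 2))) w ^ 2) *
        (∫ x : Sph (k + 2), (1 - inner ℝ (x : EuclideanSpace ℝ (Fin (k + 2)))
          (θ : EuclideanSpace ℝ (Fin (k + 2))) ^ 2) ∂rot (k + 2) θ κ f) / (k + 1)
        + inner ℝ (θ : EuclideanSpace ℝ (Fin (k + 2))) w ^ 2 *
        ∫ x : Sph (k + 2), inner ℝ (x : EuclideanSpace ℝ (Fin (k + 2)))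
          (θ : EuclideanSpace ℝ (Fin (k + 2))) ^ 2 ∂rot (k + 2) θ κ f := by
  set c : ℝ := inner ℝ (θ : EuclideanSpace ℝ (Fin (k + 2))) w with hc
  set v := w - c • (θ : EuclideanSpace ℝ (Fin (k + 2))) with hvdef
  have hv : inner ℝ (θ : EuclideanSpace ℝ (Fin (k + 2))) v = 0 := by
    rw [inner_sub_right, inner_smul_right, real_inner_self_eq_norm_sq, norm_eq_of_mem_sphere]
    simp [c]
  have hvn : ‖v‖ ^ 2 = ‖w‖ ^ 2 - c ^ 2 := by
    rw [hvdef, norm_sub_sq_real, inner_smul_right, real_inner_comm, ← hc, norm_smul,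
      norm_eq_of_mem_sphere]
    simp
    ring
  have h1 := integral_rot_inner_sq_of_orthogonal θ κ hf hv
  have h2 := integral_rot_mul_inner_eq_zero θ κ hf hv id measurable_id
  have h3 : ∀ x : Sph (k + 2), inner ℝ (x : EuclideanSpace ℝ (Fin (k + 2))) w ^ 2
      = inner ℝ (x : EuclideanSpace ℝ (Fin (k + 2))) v ^ 2
        + (2 * c) * (id (inner ℝ (x : EuclideanSpace ℝ (Fin (k + 2)))
          (θ : EuclideanSpace ℝ (Fin (k + 2)))) * inner ℝ (x : EuclideanSpace ℝ (Fin (k + 2))) v)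
        + c ^ 2 * inner ℝ (x : EuclideanSpace ℝ (Fin (k + 2)))
          (θ : EuclideanSpace ℝ (Fin (k + 2))) ^ 2 := by
    intro x
    rw [hvdef, inner_sub_right, inner_smul_right, id]
    ring
  simp_rw [h3]
  rw [integral_add (integrable_of_continuous _ (by simp only [id]; fun_prop))
      (integrable_of_continuous _ (by fun_prop)),
    integral_add (integrable_of_continuous _ (by fun_prop))
      (integrable_of_continuous _ (by simp only [id]; fun_prop)), integral_const_mul,
    integral_const_mul, h1, h2, hvn]
  ring

end HighConc

-- Laplace asymptotics of the one-dimensional integrals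

namespace HighConc

lemma intervalIntegrable_one_sub_rpow_mul_left {ξ ζ : ℝ} (hζ : -1 < ζ) :
    IntervalIntegrable (fun s : ℝ => (1 - s) ^ ξ * (1 + s) ^ ζ) volume (-1) 0 := by
  have h1 : IntervalIntegrable (fun s : ℝ => (1 + s) ^ ζ) volume (-1) 0 := by
    have h : IntervalIntegrable (fun s : ℝ => s ^ ζ) volume 0 1 :=
      intervalIntegral.intervalIntegrable_rpow' hζ
    simpa using h.comp_add_left 1
  refine h1.continuousOn_mul ?_
  refine ContinuousOn.rpow_const (by fun_prop) fun s hs => Or.inl ?_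
  rw [uIcc_of_le (by norm_num)] at hs
  linarith [hs.2]

lemma intervalIntegrable_one_sub_rpow_mul_right {ξ ζ : ℝ} (hξ : -1 < ξ) :
    IntervalIntegrable (fun s : ℝ => (1 - s) ^ ξ * (1 + s) ^ ζ) volume 0 1 := by
  have h1 : IntervalIntegrable (fun s : ℝ => (1 - s) ^ ξ) volume 0 1 := by
    have h : IntervalIntegrable (fun s : ℝ => s ^ ξ) volume 0 1 :=
      intervalIntegral.intervalIntegrable_rpow' hξ
    simpa using (h.comp_sub_left 1).symm
  refine h1.mul_continuousOn ?_
  refine ContinuousOn.rpow_const (by fun_prop) fun s hs => Or.inl ?_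
  rw [uIcc_of_le (by norm_num)] at hs
  linarith [hs.1]

lemma intervalIntegrable_one_sub_rpow_mul {ξ ζ : ℝ} (hξ : -1 < ξ) (hζ : -1 < ζ) :
    IntervalIntegrable (fun s : ℝ => (1 - s) ^ ξ * (1 + s) ^ ζ) volume (-1) 1 :=
  (intervalIntegrable_one_sub_rpow_mul_left hζ).trans
    (intervalIntegrable_one_sub_rpow_mul_right hξ)

/-- With `t = a (1 - s)` the integral becomes a Gamma integral with extra factor `(2 - t/a)^ζ`,
which tends to `2^ζ`; dominated convergence applies. -/
lemma tendsto_integral_near_one {ξ : ℝ} (ζ : ℝ) (hξ : -1 < ξ) :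
    Tendsto (fun a : ℝ => a ^ (ξ + 1) *
        ∫ s in (0 : ℝ)..1, (1 - s) ^ ξ * (1 + s) ^ ζ * Real.exp ((s - 1) * a)) atTop
      (𝓝 (2 ^ ζ * Real.Gamma (ξ + 1))) := by
  -- On `0 < t < a` the base `2 - t/a` lies in `[1, 2]`, so `K` bounds its power whatever the sign
  -- of `ζ`.
  set K : ℝ := max 1 (2 ^ ζ)
  -- The indicator keeps the domain of integration fixed as `a` grows; the exponent `ξ + 1 - 1` is
  -- left unsimplified to match the integrand of `Real.Gamma`.
  have hlim : Tendsto (fun a : ℝ => ∫ t in Ioi (0 : ℝ),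
      (Iio a).indicator (fun t => (2 - t / a) ^ ζ * (Real.exp (-t) * t ^ (ξ + 1 - 1))) t) atTop
      (𝓝 (∫ t in Ioi (0 : ℝ), 2 ^ ζ * (Real.exp (-t) * t ^ (ξ + 1 - 1)))) := by
    refine tendsto_integral_filter_of_dominated_convergence
      (fun t => K * (Real.exp (-t) * t ^ (ξ + 1 - 1))) ?_ ?_ ?_ ?_
    · refine Eventually.of_forall fun a => Measurable.aestronglyMeasurable ?_
      exact Measurable.indicator (by fun_prop) measurableSet_Iio
    · filter_upwards [eventually_gt_atTop 0] with a ha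
      filter_upwards [ae_restrict_mem measurableSet_Ioi] with t ht
      have h0 : 0 ≤ Real.exp (-t) * t ^ (ξ + 1 - 1) :=
        mul_nonneg (Real.exp_pos _).le (Real.rpow_nonneg (le_of_lt ht) _)
      by_cases hta : t ∈ Iio a
      · rw [indicator_of_mem hta]
        have h1 : 1 ≤ 2 - t / a := by
          have : t / a ≤ 1 := (div_le_one ha).2 (le_of_lt hta)
          linarith
        have h2 : 2 - t / a ≤ 2 := by
          have : 0 ≤ t / a := div_nonneg (le_of_lt ht) ha.le
          linarith
        have h3 : (2 - t / a) ^ ζ ≤ K := by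
          rcases le_total 0 ζ with hz | hz
          · exact (Real.rpow_le_rpow (by linarith) h2 hz).trans (le_max_right _ _)
          · exact (Real.rpow_le_one_of_one_le_of_nonpos h1 hz).trans (le_max_left _ _)
        rw [Real.norm_of_nonneg (mul_nonneg (Real.rpow_nonneg (by linarith) _) h0)]
        exact mul_le_mul_of_nonneg_right h3 h0
      · rw [indicator_of_notMem hta, norm_zero]
        exact mul_nonneg (zero_le_one.trans (le_max_left _ _)) h0
    · exact (Real.GammaIntegral_convergent (by linarith)).const_mul K
    · refine ae_of_all _ fun t => ?_
      have h1 : Tendsto (fun a : ℝ => (2 - t / a) ^ ζ * (Real.exp (-t) * t ^ (ξ + 1 - 1))) atTop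
          (𝓝 ((2 - 0) ^ ζ * (Real.exp (-t) * t ^ (ξ + 1 - 1)))) := by
        refine Tendsto.mul_const _ (Tendsto.rpow_const ?_ (Or.inl (by norm_num)))
        exact tendsto_const_nhds.sub (tendsto_const_nhds.div_atTop tendsto_id)
      rw [sub_zero] at h1
      refine h1.congr' ?_
      filter_upwards [eventually_gt_atTop t] with a ha
      rw [indicator_of_mem (show t ∈ Iio a from ha)]
  rw [integral_const_mul, ← Real.Gamma_eq_integral (by linarith)] at hlim
  refine hlim.congr' ?_
  filter_upwards [eventually_gt_atTop 0] with a ha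
  have hsub : ∫ s in (0 : ℝ)..1, (1 - s) ^ ξ * (1 + s) ^ ζ * Real.exp ((s - 1) * a)
      = ∫ s in (0 : ℝ)..1, s ^ ξ * (2 - s) ^ ζ * Real.exp (-(a * s)) := by
    have := intervalIntegral.integral_comp_sub_left (a := 0) (b := 1)
      (fun s : ℝ => s ^ ξ * (2 - s) ^ ζ * Real.exp (-(a * s))) 1
    simp only [sub_self, sub_zero] at this
    rw [← this]
    refine intervalIntegral.integral_congr fun s _ => ?_
    ring_nf
  have hG := integral_comp_mul_left_Ioi (fun t : ℝ => (Iio a).indicator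
      (fun t => (2 - t / a) ^ ζ * (Real.exp (-t) * t ^ (ξ + 1 - 1))) t) 0 ha
  rw [mul_zero] at hG
  have hG2 : ∫ s in Ioi (0 : ℝ), (Iio a).indicator
      (fun t => (2 - t / a) ^ ζ * (Real.exp (-t) * t ^ (ξ + 1 - 1))) (a * s)
      = a ^ ξ * ∫ s in (0 : ℝ)..1, s ^ ξ * (2 - s) ^ ζ * Real.exp (-(a * s)) := by
    rw [intervalIntegral.integral_of_le zero_le_one, integral_Ioc_eq_integral_Ioo,
      ← integral_const_mul, ← integral_indicator measurableSet_Ioi,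
      ← integral_indicator measurableSet_Ioo]
    congr 1
    ext s
    by_cases hs : 0 < s
    · by_cases hs1 : s < 1
      · have m1 : s ∈ Ioi (0 : ℝ) := hs
        have m2 : a * s ∈ Iio a := by
          simp only [mem_Iio]; nlinarith
        have m3 : s ∈ Ioo (0 : ℝ) 1 := ⟨hs, hs1⟩
        rw [indicator_of_mem m1, indicator_of_mem m2, indicator_of_mem m3,
          mul_div_cancel_left₀ _ ha.ne', add_sub_cancel_right, Real.mul_rpow ha.le hs.le]
        ring
      · have m2 : a * s ∉ Iio a := by
          simp only [mem_Iio]; nlinarith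
        rw [indicator_of_notMem (fun h : s ∈ Ioo (0 : ℝ) 1 => hs1 h.2)]
        simp only [indicator, m2, if_false, ite_self]
    · rw [indicator_of_notMem (fun h : s ∈ Ioo (0 : ℝ) 1 => hs h.1),
        indicator_of_notMem (fun h : s ∈ Ioi (0 : ℝ) => hs h)]
  rw [hsub]
  rw [hG2, smul_eq_mul] at hG
  rw [Real.rpow_add ha, Real.rpow_one]
  rw [mul_right_comm, hG, mul_comm, mul_inv_cancel_left₀ ha.ne']

/-- Only the half near `s = 1` matters: on `[-1, 0]` the exponential is at most `exp (-a)`, which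
beats the power of `a`, while the weight is integrable there. -/
lemma tendsto_integral_exp {ξ ζ : ℝ} (hξ : -1 < ξ) (hζ : -1 < ζ) :
    Tendsto (fun a : ℝ => a ^ (ξ + 1) *
        ∫ s in (-1 : ℝ)..1, (1 - s) ^ ξ * (1 + s) ^ ζ * Real.exp ((s - 1) * a)) atTop
      (𝓝 (2 ^ ζ * Real.Gamma (ξ + 1))) := by
  have hL := intervalIntegrable_one_sub_rpow_mul_left (ξ := ξ) hζ
  have hR := intervalIntegrable_one_sub_rpow_mul_right (ζ := ζ) hξ
  set B : ℝ := ∫ s in (-1 : ℝ)..0, (1 - s) ^ ξ * (1 + s) ^ ζ with hB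
  have h0 : Tendsto (fun a : ℝ => a ^ (ξ + 1) *
        ∫ s in (-1 : ℝ)..0, (1 - s) ^ ξ * (1 + s) ^ ζ * Real.exp ((s - 1) * a)) atTop
      (𝓝 0) := by
    have hb : Tendsto (fun a : ℝ => (a ^ (ξ + 1) * Real.exp (-1 * a)) * B) atTop (𝓝 (0 * B)) :=
      (tendsto_rpow_mul_exp_neg_mul_atTop_nhds_zero (ξ + 1) 1 one_pos).mul_const B
    rw [zero_mul] at hb
    refine squeeze_zero' ?_ ?_ hb
    · filter_upwards [eventually_ge_atTop 0] with a ha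
      refine mul_nonneg (Real.rpow_nonneg ha _) (intervalIntegral.integral_nonneg (by norm_num) ?_)
      intro s hs
      exact mul_nonneg (mul_nonneg (Real.rpow_nonneg (by linarith [hs.2]) _)
        (Real.rpow_nonneg (by linarith [hs.1]) _)) (Real.exp_pos _).le
    · filter_upwards [eventually_ge_atTop 0] with a ha
      rw [mul_assoc]
      refine mul_le_mul_of_nonneg_left ?_ (Real.rpow_nonneg ha _)
      rw [hB, ← intervalIntegral.integral_const_mul]
      refine intervalIntegral.integral_mono_on (by norm_num) ?_ (hL.const_mul _) ?_
      · exact hL.mul_continuousOn (by fun_prop)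
      · intro s hs
        rw [mul_comm]
        refine mul_le_mul_of_nonneg_right (Real.exp_le_exp.2 ?_) ?_
        · nlinarith [hs.2]
        · exact mul_nonneg (Real.rpow_nonneg (by linarith [hs.2]) _)
            (Real.rpow_nonneg (by linarith [hs.1]) _)
  have h1 := h0.add (tendsto_integral_near_one ζ hξ)
  rw [zero_add] at h1
  refine h1.congr fun a => ?_
  rw [← mul_add, intervalIntegral.integral_add_adjacent_intervals]
  · exact hL.mul_continuousOn (by fun_prop)
  · exact hR.mul_continuousOn (by fun_prop)

lemma intervalIntegrable_mul_angular {f : ℝ → ℝ} (hf : AngularClass f) {ξ ζ κ : ℝ} (hξ : -1 < ξ)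
    (hζ : -1 < ζ) (hκ : 0 < κ) :
    IntervalIntegrable (fun s : ℝ => (1 - s) ^ ξ * (1 + s) ^ ζ * (f (κ * s) / f κ)) volume
      (-1) 1 := by
  have h := intervalIntegrable_one_sub_rpow_mul hξ hζ
  have hfm : Measurable f := hf.monotone.measurable
  rw [intervalIntegrable_iff_integrableOn_Ioc_of_le (by norm_num)] at h ⊢
  refine Integrable.mul_bdd (c := 1) h ?_ ?_
  · exact Measurable.aestronglyMeasurable (by fun_prop)
  · filter_upwards [ae_restrict_mem measurableSet_Ioc] with s hs
    rw [Real.norm_of_nonneg (div_nonneg (hf.nonneg _) (hf.nonneg _)), div_le_one (hf.pos hκ)]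
    exact hf.monotone (by nlinarith [hs.2])

/-- Asymptotics of the weighted integrals of an angular function under high concentration. -/
lemma tendsto_integral_angular {f : ℝ → ℝ} (hf : AngularClass f) {ξ ζ : ℝ} (hξ : -1 < ξ)
    (hζ : -1 < ζ) :
    Tendsto (fun κ : ℝ => (κ * phi f κ) ^ (ξ + 1) *
        ∫ s in (-1 : ℝ)..1, (1 - s) ^ ξ * (1 + s) ^ ζ * (f (κ * s) / f κ)) atTop
      (𝓝 (2 ^ ζ * Real.Gamma (ξ + 1))) := by
  have h1 := (tendsto_integral_exp hξ hζ).comp hf.tendsto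
  -- This is condition (d), read as convergence to zero of the ratio to the comparison rate.
  have h2 : Tendsto (fun κ : ℝ => (κ * phi f κ) ^ (ξ + 1) *
      ∫ s in (-1 : ℝ)..1, (1 - s) ^ ξ * (1 + s) ^ ζ *
        |f (κ * s) / f κ - Real.exp ((s - 1) * (κ * phi f κ))|) atTop (𝓝 0) := by
    refine ((hf.approx ξ ζ hξ hζ).tendsto_div_nhds_zero).congr fun κ => ?_
    rw [div_div_eq_mul_div, div_one, mul_comm]
  have h3 : Tendsto (fun κ : ℝ => (κ * phi f κ) ^ (ξ + 1) *
      (∫ s in (-1 : ℝ)..1, (1 - s) ^ ξ * (1 + s) ^ ζ * (f (κ * s) / f κ)) -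
      (κ * phi f κ) ^ (ξ + 1) * ∫ s in (-1 : ℝ)..1, (1 - s) ^ ξ * (1 + s) ^ ζ *
        Real.exp ((s - 1) * (κ * phi f κ))) atTop (𝓝 0) := by
    refine squeeze_zero_norm' ?_ h2
    filter_upwards [eventually_gt_atTop 0, hf.tendsto.eventually_ge_atTop 0] with κ hκ ha
    have i1 := intervalIntegrable_mul_angular hf hξ hζ hκ
    have i2 : IntervalIntegrable (fun s : ℝ => (1 - s) ^ ξ * (1 + s) ^ ζ *
        Real.exp ((s - 1) * (κ * phi f κ))) volume (-1) 1 :=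
      (intervalIntegrable_one_sub_rpow_mul hξ hζ).mul_continuousOn (by fun_prop)
    rw [← mul_sub, ← intervalIntegral.integral_sub i1 i2, norm_mul,
      Real.norm_of_nonneg (Real.rpow_nonneg ha _)]
    refine mul_le_mul_of_nonneg_left ?_ (Real.rpow_nonneg ha _)
    refine (intervalIntegral.norm_integral_le_integral_norm (by norm_num)).trans (le_of_eq ?_)
    refine intervalIntegral.integral_congr fun s hs => ?_
    rw [uIcc_of_le (by norm_num)] at hs
    have hn : 0 ≤ (1 - s) ^ ξ * (1 + s) ^ ζ := mul_nonneg
      (Real.rpow_nonneg (by linarith [hs.2]) _) (Real.rpow_nonneg (by linarith [hs.1]) _)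
    rw [← mul_sub, norm_mul, Real.norm_of_nonneg hn, Real.norm_eq_abs]
  have h4 := h3.add h1
  rw [zero_add] at h4
  exact h4.congr fun κ => by simp

/-- The moments of `1 - x'θ` under high concentration. -/
lemma tendsto_moment {k : ℕ} {f : ℝ → ℝ} (hf : AngularClass f) {κ : ℕ → ℝ}
    (hκ : Tendsto κ atTop atTop) (θ : ℕ → Sph (k + 2))
    (hP : ∀ᶠ n in atTop, IsProbabilityMeasure (rot (k + 2) (θ n) (κ n) f)) {η : ℝ} (hη : 0 ≤ η) :
    Tendsto (fun n => (κ n * phi f (κ n)) ^ η *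
      ∫ x : Sph (k + 2), (1 - inner ℝ (x : EuclideanSpace ℝ (Fin (k + 2)))
          (θ n : EuclideanSpace ℝ (Fin (k + 2)))) ^ η ∂rot (k + 2) (θ n) (κ n) f) atTop
      (𝓝 (Real.Gamma (((k : ℝ) - 1) / 2 + η + 1) / Real.Gamma (((k : ℝ) - 1) / 2 + 1))) := by
  set ξ : ℝ := ((k : ℝ) - 1) / 2 with hξdef
  have hξ : -1 < ξ := by
    have : (0 : ℝ) ≤ k := Nat.cast_nonneg k
    rw [hξdef]; linarith
  -- Numerator and denominator of the moment differ only in the exponent of `1 - s`, so `2^ξ` and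
  -- `f(κ)` cancel and a ratio of Gamma values remains.
  have hn := (tendsto_integral_angular hf (ξ := ξ + η) (ζ := ξ) (by linarith) hξ).comp hκ
  have hd := (tendsto_integral_angular hf hξ hξ).comp hκ
  have hG : Real.Gamma (ξ + 1) ≠ 0 := (Real.Gamma_pos_of_pos (by linarith)).ne'
  have h2 : (2 : ℝ) ^ ξ ≠ 0 := (Real.rpow_pos_of_pos two_pos _).ne'
  have h := hn.div hd (mul_ne_zero h2 hG)
  rw [mul_div_mul_left _ _ h2] at h
  refine h.congr' ?_
  filter_upwards [hP, hκ.eventually_gt_atTop 0,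
    (hf.tendsto.comp hκ).eventually_gt_atTop 0] with n hPn hκn ha
  simp only [Function.comp_apply] at ha
  rw [integral_rot_one_sub_rpow (θ n) (κ n) hf η]
  simp only [Function.comp_apply, Pi.div_apply]
  simp_rw [← mul_div_assoc, intervalIntegral.integral_div]
  have e : (κ n * phi f (κ n)) ^ (ξ + η + 1)
      = (κ n * phi f (κ n)) ^ η * (κ n * phi f (κ n)) ^ (ξ + 1) := by
    rw [← Real.rpow_add ha]; ring_nf
  have hp : (κ n * phi f (κ n)) ^ (ξ + 1) ≠ 0 := (Real.rpow_pos_of_pos ha _).ne'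
  have hfn : f (κ n) ≠ 0 := (hf.pos hκn).ne'
  rw [e]
  simp only [← hξdef]
  field_simp

end HighConc

-- Convergence in probability and Slutsky arguments on varying spaces

namespace HighConc

section Probability

variable {Ω : ℕ → Type*} [∀ n, MeasurableSpace (Ω n)] {P : ∀ n, Measure (Ω n)}

/-- Convergence in probability to a constant, on varying probability spaces. -/
def ConvProb {E : Type*} [PseudoMetricSpace E] (P : ∀ n, Measure (Ω n)) (Y : ∀ n, Ω n → E)
    (c : E) : Prop :=
  ∀ ε : ℝ, 0 < ε → Tendsto (fun n => P n {ω | ε ≤ dist (Y n ω) c}) atTop (𝓝 0)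

lemma ConvProb.comp {E F : Type*} [PseudoMetricSpace E] [PseudoMetricSpace F]
    {Y : ∀ n, Ω n → E} {c : E} (h : ConvProb P Y c) {g : E → F} (hg : ContinuousAt g c) :
    ConvProb P (fun n ω => g (Y n ω)) (g c) := by
  intro ε hε
  obtain ⟨δ, hδ, hd⟩ := Metric.continuousAt_iff.1 hg ε hε
  refine tendsto_of_tendsto_of_tendsto_of_le_of_le tendsto_const_nhds (h δ hδ)
    (fun n => zero_le) fun n => measure_mono fun ω hω => ?_
  by_contra hlt
  exact absurd (hd (not_le.1 hlt)) (not_lt.2 hω)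

lemma ConvProb.congr {E : Type*} [PseudoMetricSpace E] {Y Y' : ∀ n, Ω n → E} {c : E}
    (h : ConvProb P Y c) (he : ∀ᶠ n in atTop, ∀ ω, Y n ω = Y' n ω) : ConvProb P Y' c := by
  intro ε hε
  refine (h ε hε).congr' ?_
  filter_upwards [he] with n hn
  simp only [hn]

lemma ConvProb.prodMk {E F : Type*} [PseudoMetricSpace E] [PseudoMetricSpace F]
    {Y : ∀ n, Ω n → E} {c : E} {Z : ∀ n, Ω n → F} {d : F} (h : ConvProb P Y c)
    (h' : ConvProb P Z d) : ConvProb P (fun n ω => (Y n ω, Z n ω)) (c, d) := by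
  intro ε hε
  have hs := (h ε hε).add (h' ε hε)
  rw [add_zero] at hs
  refine tendsto_of_tendsto_of_tendsto_of_le_of_le tendsto_const_nhds hs
    (fun n => zero_le) fun n => ?_
  refine (measure_mono fun ω hω => ?_).trans (measure_union_le _ _)
  simpa [Prod.dist_eq] using hω

/-- Chebyshev's inequality: half of `ε` pays for the distance of the mean to `c`, the other half for
the fluctuation. -/
lemma convProb_of_variance [∀ n, IsProbabilityMeasure (P n)] {Y : ∀ n, Ω n → ℝ} {c : ℝ}
    (hY : ∀ n, MemLp (Y n) 2 (P n)) (hm : Tendsto (fun n => ∫ ω, Y n ω ∂P n) atTop (𝓝 c))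
    (hv : Tendsto (fun n => Var[Y n; P n]) atTop (𝓝 0)) : ConvProb P Y c := by
  intro ε hε
  have hb : Tendsto (fun n => ENNReal.ofReal (Var[Y n; P n] / (ε / 2) ^ 2)) atTop (𝓝 0) := by
    have := ENNReal.tendsto_ofReal (hv.div_const ((ε / 2) ^ 2))
    simpa using this
  refine tendsto_of_tendsto_of_tendsto_of_le_of_le' tendsto_const_nhds hb
    (Eventually.of_forall fun n => zero_le) ?_
  filter_upwards [Metric.tendsto_nhds.1 hm (ε / 2) (by positivity)] with n hn
  refine (measure_mono fun ω hω => ?_).trans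
    (meas_ge_le_variance_div_sq (hY n) (by positivity : 0 < ε / 2))
  simp only [mem_ofPred_eq] at hω ⊢
  have := dist_triangle (Y n ω) (∫ x, Y n x ∂P n) c
  rw [Real.dist_eq (Y n ω) (∫ x, Y n x ∂P n)] at this
  linarith

lemma convProb_of_integral_dist {E : Type*} [PseudoMetricSpace E]
    {Y : ∀ n, Ω n → E} {c : E} (hi : ∀ n, Integrable (fun ω => dist (Y n ω) c) (P n))
    (hm : Tendsto (fun n => ∫ ω, dist (Y n ω) c ∂P n) atTop (𝓝 0)) : ConvProb P Y c := by
  intro ε hε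
  have hb : Tendsto (fun n => ENNReal.ofReal ((∫ ω, dist (Y n ω) c ∂P n) / ε)) atTop (𝓝 0) := by
    have := ENNReal.tendsto_ofReal (hm.div_const ε)
    simpa using this
  refine tendsto_of_tendsto_of_tendsto_of_le_of_le tendsto_const_nhds hb
    (fun n => zero_le) fun n => ?_
  have h := meas_ge_le_lintegral_div (μ := P n) (f := fun ω => ENNReal.ofReal (dist (Y n ω) c))
    (hi n).aemeasurable.ennreal_ofReal (ε := ENNReal.ofReal ε) (by simpa using hε)
    ENNReal.ofReal_ne_top
  rw [ENNReal.ofReal_div_of_pos hε,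
    ofReal_integral_eq_lintegral_ofReal (hi n) (ae_of_all _ fun ω => dist_nonneg)]
  refine (measure_mono fun ω hω => ?_).trans h
  exact ENNReal.ofReal_le_ofReal hω

lemma tendsto_charFun_of_tendstoInDistribution [∀ n, IsProbabilityMeasure (P n)]
    {Ω' : Type*} [MeasurableSpace Ω'] {μ : Measure Ω'} [IsProbabilityMeasure μ]
    {X : ∀ n, Ω n → ℝ} {Z : Ω' → ℝ} (hX : TendstoInDistribution X atTop Z P μ) (t : ℝ) :
    Tendsto (fun n => charFun ((P n).map (X n)) t) atTop (𝓝 (charFun (μ.map Z) t)) :=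
  ProbabilityMeasure.tendsto_iff_tendsto_charFun.1 hX.tendsto t

/-- The map `y ↦ exp (i t y)` is `|t|`-Lipschitz, which is used where `X` and `Y` are within `δ`;
elsewhere the difference is at most `2`. -/
lemma norm_charFun_sub_le {Ω₁ : Type*} [MeasurableSpace Ω₁] {μ : Measure Ω₁}
    [IsProbabilityMeasure μ] {X Y : Ω₁ → ℝ} (hX : AEMeasurable X μ) (hY : AEMeasurable Y μ)
    (t δ : ℝ) (hδ : 0 < δ) :
    ‖charFun (μ.map Y) t - charFun (μ.map X) t‖
      ≤ |t| * δ + 2 * μ.real {ω | δ ≤ dist (Y ω - X ω) 0} := by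
  rw [charFun_apply_real, charFun_apply_real, integral_map hY (by fun_prop),
    integral_map hX (by fun_prop)]
  have hint : ∀ {V : Ω₁ → ℝ}, AEMeasurable V μ →
      Integrable (fun ω => Complex.exp (t * V ω * Complex.I)) μ := by
    intro V hV
    refine Integrable.of_bound (C := 1) (AEMeasurable.aestronglyMeasurable (by fun_prop)) ?_
    refine ae_of_all _ fun ω => ?_
    rw [← Complex.ofReal_mul, Complex.norm_exp_ofReal_mul_I]
  rw [← integral_sub (hint hY) (hint hX)]
  set A : Set Ω₁ := {ω | δ ≤ dist (Y ω - X ω) 0} with hA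
  have hAm : NullMeasurableSet A μ :=
    nullMeasurableSet_le aemeasurable_const ((hY.sub hX).dist aemeasurable_const)
  have hbound : ∀ ω, ‖Complex.exp (t * Y ω * Complex.I) - Complex.exp (t * X ω * Complex.I)‖
      ≤ |t| * δ + A.indicator (fun _ => (2 : ℝ)) ω := by
    intro ω
    by_cases hω : ω ∈ A
    · rw [indicator_of_mem hω]
      have h1 := norm_sub_le (Complex.exp (t * Y ω * Complex.I)) (Complex.exp (t * X ω * Complex.I))
      rw [← Complex.ofReal_mul, ← Complex.ofReal_mul, Complex.norm_exp_ofReal_mul_I,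
        Complex.norm_exp_ofReal_mul_I] at h1
      push_cast at h1
      have : 0 ≤ |t| * δ := by positivity
      linarith
    · rw [indicator_of_notMem hω, add_zero]
      have e : Complex.exp (t * Y ω * Complex.I) - Complex.exp (t * X ω * Complex.I)
          = Complex.exp ((t * X ω : ℝ) * Complex.I) *
            (Complex.exp (Complex.I * (t * (Y ω - X ω) : ℝ)) - 1) := by
        rw [mul_sub, ← Complex.exp_add, mul_one]
        congr 2
        · push_cast; ring
        · push_cast; ring
      rw [e, norm_mul, Complex.norm_exp_ofReal_mul_I, one_mul]
      refine Real.norm_exp_I_mul_ofReal_sub_one_le.trans ?_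
      rw [norm_mul, Real.norm_eq_abs, Real.norm_eq_abs]
      simp only [hA, mem_ofPred_eq, not_le, dist_zero_right, Real.norm_eq_abs] at hω
      exact mul_le_mul_of_nonneg_left hω.le (abs_nonneg _)
  have hind : Integrable (A.indicator (fun _ => (2 : ℝ))) μ :=
    (integrable_const _).indicator₀ hAm
  refine (norm_integral_le_integral_norm _).trans ((integral_mono
    ((hint hY).sub (hint hX)).norm ((integrable_const _).add hind) hbound).trans (le_of_eq ?_))
  simp only [Pi.add_apply]
  rw [integral_add (integrable_const _) hind, integral_indicator₀ hAm]
  simp [mul_comm]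

/-- **Slutsky's theorem** on varying probability spaces. -/
lemma tendstoInDistribution_of_convProb_sub [∀ n, IsProbabilityMeasure (P n)]
    {Ω' : Type*} [MeasurableSpace Ω'] {μ : Measure Ω'} [IsProbabilityMeasure μ]
    {X Y : ∀ n, Ω n → ℝ} {Z : Ω' → ℝ} (hX : TendstoInDistribution X atTop Z P μ)
    (hXY : ConvProb P (fun n ω => Y n ω - X n ω) 0) (hY : ∀ n, AEMeasurable (Y n) (P n)) :
    TendstoInDistribution Y atTop Z P μ where
  forall_aemeasurable := hY
  aemeasurable_limit := hX.aemeasurable_limit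
  tendsto := by
    refine ProbabilityMeasure.tendsto_iff_tendsto_charFun.2 fun t => ?_
    have h1 := tendsto_charFun_of_tendstoInDistribution hX t
    have h2 : Tendsto (fun n => charFun ((P n).map (Y n)) t - charFun ((P n).map (X n)) t) atTop
        (𝓝 0) := by
      rw [Metric.tendsto_nhds]
      intro ε hε
      -- This makes `|t| * δ` at most `ε / 2`; the summand `1` covers `t = 0`.
      set δ : ℝ := ε / (2 * (|t| + 1)) with hδd
      have hδ : 0 < δ := by positivity
      have h3 : Tendsto (fun n => |t| * δ + 2 * (P n).real {ω | δ ≤ dist (Y n ω - X n ω) 0}) atTop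
          (𝓝 (|t| * δ + 2 * 0)) := by
        refine tendsto_const_nhds.add (Tendsto.const_mul _ ?_)
        have := (ENNReal.tendsto_toReal ENNReal.zero_ne_top).comp (hXY δ hδ)
        simpa [Measure.real, Function.comp_def] using this
      have h4 : |t| * δ + 2 * 0 < ε := by
        have : |t| * δ = ε / 2 * (|t| / (|t| + 1)) := by rw [hδd]; field_simp
        have h5 : |t| / (|t| + 1) < 1 := (div_lt_one (by positivity)).2 (by linarith)
        rw [this]
        nlinarith
      filter_upwards [h3.eventually_lt_const h4] with n hn
      rw [dist_zero_right]
      exact (norm_charFun_sub_le (hX.forall_aemeasurable n) (hY n) t δ hδ).trans_lt hn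
    have h5 := h2.add h1
    simpa using h5

/-- A bounded-in-probability sequence times a negligible one is negligible. -/
lemma ConvProb.mul_of_tendstoInDistribution [∀ n, IsProbabilityMeasure (P n)]
    {Ω' : Type*} [MeasurableSpace Ω'] {μ : Measure Ω'} [IsProbabilityMeasure μ]
    {X A : ∀ n, Ω n → ℝ} {Z : Ω' → ℝ} (hA : ConvProb P A 0)
    (hX : TendstoInDistribution X atTop Z P μ) :
    ConvProb P (fun n ω => A n ω * X n ω) 0 := by
  intro ε hε
  have : ∀ n, IsProbabilityMeasure ((P n).map (X n)) := fun n =>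
    Measure.isProbabilityMeasure_map (hX.forall_aemeasurable n)
  have : IsProbabilityMeasure (μ.map Z) := Measure.isProbabilityMeasure_map hX.aemeasurable_limit
  -- Converging characteristic functions with a continuous limit make the laws of `X n` tight. Off
  -- an event of small probability `|X n| ≤ R`, so a product of size `ε` forces `|A n| ≥ ε / (|R| +
  -- 1)`.
  have ht : IsTightMeasureSet (Set.range fun n => (P n).map (X n)) :=
    isTightMeasureSet_of_tendsto_charFun (f := charFun (μ.map Z)) (by fun_prop)
      (tendsto_charFun_of_tendstoInDistribution hX)
  rw [isTightMeasureSet_iff_exists_isCompact_measure_compl_le] at ht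
  rw [ENNReal.tendsto_nhds_zero]
  intro η hη
  obtain ⟨K, hK, hKη⟩ := ht (η / 2) (ENNReal.half_pos hη.ne')
  obtain ⟨R, hR⟩ := hK.isBounded.subset_closedBall (0 : ℝ)
  have hA' := ENNReal.tendsto_nhds_zero.1 (hA (ε / (|R| + 1)) (by positivity)) (η / 2)
    (ENNReal.half_pos hη.ne')
  filter_upwards [hA'] with n hn
  have h1 : P n {ω | X n ω ∈ Kᶜ} ≤ η / 2 := by
    have := hKη _ ⟨n, rfl⟩
    simp only at this
    rwa [Measure.map_apply_of_aemeasurable (hX.forall_aemeasurable n) hK.measurableSet.compl]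
      at this
  rw [← ENNReal.add_halves η]
  refine (measure_mono fun ω hω => ?_).trans ((measure_union_le _ _).trans (add_le_add h1 hn))
  by_cases hx : X n ω ∈ K
  · right
    simp only [mem_ofPred_eq, dist_zero_right, Real.norm_eq_abs] at hω ⊢
    have h2 : |X n ω| ≤ R := by simpa using hR hx
    rw [abs_mul] at hω
    rw [div_le_iff₀ (by positivity)]
    refine hω.trans (mul_le_mul_of_nonneg_left ?_ (abs_nonneg _))
    linarith [le_abs_self R]
  · exact Or.inl hx

end Probability

-- Central limit theorem for triangular arrays

/-- Being valid for all real `x`, the bound lets third absolute moments control the remainder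
without truncation. The constant is crude: for `|x| ≥ 1` the left side is at most `2 + |x| + |x|²/2
≤ (7/2) |x|³`. -/
lemma norm_exp_mul_I_sub_le (x : ℝ) :
    ‖Complex.exp (x * Complex.I) - (1 + x * Complex.I - x ^ 2 / 2)‖ ≤ 4 * |x| ^ 3 := by
  rcases le_total |x| 1 with h | h
  · have hx : ‖(x : ℂ) * Complex.I‖ = |x| := by simp
    have := Complex.exp_bound (x := x * Complex.I) (by rw [hx]; exact h) (n := 3) (by norm_num)
    rw [hx] at this
    have e : ∑ m ∈ Finset.range 3, ((x : ℂ) * Complex.I) ^ m / (m.factorial : ℂ)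
        = 1 + x * Complex.I - x ^ 2 / 2 := by
      simp [Finset.sum_range_succ, mul_pow]
      ring
    rw [e] at this
    refine this.trans ?_
    rw [mul_comm]
    refine mul_le_mul_of_nonneg_right ?_ (by positivity)
    norm_num [Nat.factorial]
  · have h1 : ‖Complex.exp (x * Complex.I)‖ = 1 := Complex.norm_exp_ofReal_mul_I x
    have h2 : ‖(1 + x * Complex.I - x ^ 2 / 2 : ℂ)‖ ≤ 1 + |x| + |x| ^ 2 / 2 := by
      refine (norm_sub_le _ _).trans (add_le_add ((norm_add_le _ _).trans ?_) ?_)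
      · simp
      · simp
    refine (norm_sub_le _ _).trans ?_
    rw [h1]
    nlinarith [mul_le_mul h h zero_le_one (abs_nonneg x), pow_le_pow_right₀ h (show 2 ≤ 3 by norm_num),
      pow_le_pow_right₀ h (show 1 ≤ 3 by norm_num), one_le_pow₀ h (n := 3)]

/-- The characteristic function form of the central limit theorem for triangular arrays with rows
of independent identically distributed variables. -/
lemma tendsto_integral_exp_pow {S : ℕ → Type*} [∀ n, MeasurableSpace (S n)]
    {Q : ∀ n, Measure (S n)} {z : ∀ n, S n → ℝ} {v : ℝ}
    (hQ : ∀ᶠ n in atTop, IsProbabilityMeasure (Q n))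
    (h1 : ∀ᶠ n in atTop, Integrable (z n) (Q n))
    (h2 : ∀ᶠ n in atTop, Integrable (fun x => z n x ^ 2) (Q n))
    (h3 : ∀ᶠ n in atTop, Integrable (fun x => |z n x| ^ 3) (Q n))
    (m1 : Tendsto (fun n : ℕ => n * ∫ x, z n x ∂Q n) atTop (𝓝 0))
    (m2 : Tendsto (fun n : ℕ => n * ∫ x, z n x ^ 2 ∂Q n) atTop (𝓝 v))
    (m3 : Tendsto (fun n : ℕ => n * ∫ x, |z n x| ^ 3 ∂Q n) atTop (𝓝 0)) :
    Tendsto (fun n : ℕ => (∫ x, Complex.exp (z n x * Complex.I) ∂Q n) ^ n) atTop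
      (𝓝 (Complex.exp (-(v / 2 : ℝ)))) := by
  -- By the limit `(1 + y_n/n)^n → exp y` for `y_n → y`, it suffices to find the limit of `n` times
  -- the characteristic function minus one. In the second-order expansion the mean term vanishes by
  -- `m1`, the quadratic term gives `-v/2`, and the remainder is controlled by `m3`.
  have key : Tendsto (fun n : ℕ => (n : ℂ) * ((∫ x, Complex.exp (z n x * Complex.I) ∂Q n) - 1))
      atTop (𝓝 (-(v / 2 : ℝ) : ℂ)) := by
    have hA : Tendsto (fun n : ℕ => (((n * ∫ x, z n x ∂Q n : ℝ) : ℂ) * Complex.I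
        - ((n * ∫ x, z n x ^ 2 ∂Q n : ℝ) : ℂ) / 2)) atTop
        (𝓝 (((0 : ℝ) : ℂ) * Complex.I - (v : ℂ) / 2)) :=
      ((Complex.continuous_ofReal.tendsto _).comp m1 |>.mul_const _).sub
        ((Complex.continuous_ofReal.tendsto _).comp m2 |>.div_const _)
    have hB : Tendsto (fun n : ℕ => (n : ℂ) * ((∫ x, Complex.exp (z n x * Complex.I) ∂Q n) - 1) -
        (((n * ∫ x, z n x ∂Q n : ℝ) : ℂ) * Complex.I
          - ((n * ∫ x, z n x ^ 2 ∂Q n : ℝ) : ℂ) / 2)) atTop (𝓝 0) := by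
      have m3' := m3.const_mul 4
      rw [mul_zero] at m3'
      refine squeeze_zero_norm' ?_ m3'
      filter_upwards [hQ, h1, h2, h3] with n hn i1 i2 i3
      have i0 : Integrable (fun x => Complex.exp (z n x * Complex.I)) (Q n) := by
        refine Integrable.of_bound (C := 1) ?_ (ae_of_all _ fun x => ?_)
        · have := i1.aemeasurable
          exact AEMeasurable.aestronglyMeasurable (by fun_prop)
        · rw [Complex.norm_exp_ofReal_mul_I]
      have j1 : Integrable (fun x => (z n x : ℂ) * Complex.I) (Q n) := i1.ofReal.mul_const _
      have j2 : Integrable (fun x => (z n x : ℂ) ^ 2 / 2) (Q n) := by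
        have := (i2.ofReal (𝕜 := ℂ)).div_const 2
        simpa using this
      have e : (n : ℂ) * ((∫ x, Complex.exp (z n x * Complex.I) ∂Q n) - 1) -
          (((n * ∫ x, z n x ∂Q n : ℝ) : ℂ) * Complex.I
            - ((n * ∫ x, z n x ^ 2 ∂Q n : ℝ) : ℂ) / 2)
          = n * ∫ x, (Complex.exp (z n x * Complex.I) -
            (1 + z n x * Complex.I - (z n x : ℂ) ^ 2 / 2)) ∂Q n := by
        have j0 : Integrable (fun x => 1 + (z n x : ℂ) * Complex.I) (Q n) :=
          (integrable_const _).add j1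
        have j3 : Integrable (fun x => 1 + (z n x : ℂ) * Complex.I - (z n x : ℂ) ^ 2 / 2) (Q n) :=
          j0.sub j2
        rw [integral_sub i0 j3, integral_sub j0 j2, integral_add (integrable_const _) j1,
          integral_mul_const, integral_div, integral_complex_ofReal]
        have : ∫ x, (z n x : ℂ) ^ 2 ∂Q n = ((∫ x, z n x ^ 2 ∂Q n : ℝ) : ℂ) := by
          rw [← integral_complex_ofReal]; simp
        rw [this]
        simp
        ring
      rw [e, norm_mul, Complex.norm_natCast, mul_left_comm, ← integral_const_mul]
      refine mul_le_mul_of_nonneg_left ?_ (Nat.cast_nonneg _)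
      refine norm_integral_le_of_norm_le (i3.const_mul 4) (ae_of_all _ fun x => ?_)
      exact norm_exp_mul_I_sub_le _
    have := hB.add hA
    simp only [sub_add_cancel] at this
    refine this.trans (le_of_eq ?_)
    congr 1
    push_cast
    ring
  have := Complex.tendsto_one_add_pow_exp_of_tendsto key
  simpa using this

end HighConc

-- Moment asymptotics along a local sequence

namespace HighConc

/-- The effective concentration `κ_n φ_f(κ_n)`. -/
noncomputable def conc (f : ℝ → ℝ) (κ : ℕ → ℝ) (n : ℕ) : ℝ := κ n * phi f (κ n)

/-- A sequence of high-concentration models with locations contiguous to `θ₀`. -/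
structure LocalSequence {k : ℕ} (f : ℝ → ℝ) (κ : ℕ → ℝ)
    (τ : ℕ → EuclideanSpace ℝ (Fin (k + 2))) (τlim : EuclideanSpace ℝ (Fin (k + 2)))
    (θ₀ : Sph (k + 2)) (θ : ℕ → Sph (k + 2)) : Prop where
  angular : AngularClass f
  tendsto_kappa : Tendsto κ atTop atTop
  tendsto_dir : Tendsto τ atTop (𝓝 τlim)
  loc_eq : ∀ n, (θ n : EuclideanSpace ℝ (Fin (k + 2))) = θ₀ + rate f κ n • τ n
  prob : ∀ᶠ n in atTop, IsProbabilityMeasure (rot (k + 2) (θ n) (κ n) f)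

namespace LocalSequence

variable {k : ℕ} {f : ℝ → ℝ} {κ : ℕ → ℝ} {τ : ℕ → EuclideanSpace ℝ (Fin (k + 2))}
  {τlim : EuclideanSpace ℝ (Fin (k + 2))} {θ₀ : Sph (k + 2)} {θ : ℕ → Sph (k + 2)}

lemma tendsto_conc (h : LocalSequence f κ τ τlim θ₀ θ) : Tendsto (conc f κ) atTop atTop :=
  h.angular.tendsto.comp h.tendsto_kappa

/-- The identity can fail for finitely many `n`, where `conc` need not be positive or `n = 0`; there
the square root and the rate both take the value zero. -/
lemma eventually_sqrt_mul_rate (h : LocalSequence f κ τ τlim θ₀ θ) :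
    ∀ᶠ n : ℕ in atTop, √(n * conc f κ n) * rate f κ n = 1 := by
  filter_upwards [h.tendsto_conc.eventually_gt_atTop 0, eventually_gt_atTop 0] with n ha hn
  have hn' : (0 : ℝ) < n := Nat.cast_pos.2 hn
  have : 0 < √(n * conc f κ n) := Real.sqrt_pos.2 (mul_pos hn' ha)
  rw [rate, mul_assoc (n : ℝ)]
  change √(n * conc f κ n) * (1 / √(n * conc f κ n)) = 1
  field_simp

/-- At the scale `√(n a_n)` the location has tangential drift exactly `τ n`: this is the source of
the non-centrality. -/
lemma eventually_sqrt_mul_inner (h : LocalSequence f κ τ τlim θ₀ θ)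
    {w : EuclideanSpace ℝ (Fin (k + 2))}
    (hw : inner ℝ (θ₀ : EuclideanSpace ℝ (Fin (k + 2))) w = 0) :
    ∀ᶠ n : ℕ in atTop, √(n * conc f κ n) *
      inner ℝ (θ n : EuclideanSpace ℝ (Fin (k + 2))) w = inner ℝ (τ n) w := by
  filter_upwards [h.eventually_sqrt_mul_rate] with n hn
  rw [h.loc_eq n, inner_add_left, hw, zero_add, real_inner_smul_left, ← mul_assoc, hn, one_mul]

lemma tendsto_rate (h : LocalSequence f κ τ τlim θ₀ θ) :
    Tendsto (rate f κ) atTop (𝓝 0) := by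
  have h1 : Tendsto (fun n : ℕ => √(n * conc f κ n)) atTop atTop :=
    Real.tendsto_sqrt_atTop.comp (tendsto_natCast_atTop_atTop.atTop_mul_atTop₀ h.tendsto_conc)
  refine (tendsto_inv_atTop_zero.comp h1).congr fun n => ?_
  simp [rate, conc, mul_assoc]

lemma tendsto_loc (h : LocalSequence f κ τ τlim θ₀ θ) :
    Tendsto (fun n => (θ n : EuclideanSpace ℝ (Fin (k + 2)))) atTop
      (𝓝 (θ₀ : EuclideanSpace ℝ (Fin (k + 2)))) := by
  have h1 := (tendsto_const_nhds (x := (θ₀ : EuclideanSpace ℝ (Fin (k + 2))))).add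
    (h.tendsto_rate.smul h.tendsto_dir)
  rw [zero_smul, add_zero] at h1
  exact h1.congr fun n => (h.loc_eq n).symm

lemma norm_sub_sq_sph {p : ℕ} (x y : Sph p) :
    ‖(x : EuclideanSpace ℝ (Fin p)) - y‖ ^ 2
      = 2 * (1 - inner ℝ (x : EuclideanSpace ℝ (Fin p)) (y : EuclideanSpace ℝ (Fin p))) := by
  rw [norm_sub_sq_real, norm_eq_of_mem_sphere, norm_eq_of_mem_sphere]
  ring

/-- For unit vectors `1 - θ_n'θ₀ = ‖θ_n - θ₀‖² / 2 = ν_n² ‖τ_n‖² / 2`, so the product is eventually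
`‖τ_n‖² / (2n)`. -/
lemma tendsto_conc_mul_one_sub_inner (h : LocalSequence f κ τ τlim θ₀ θ) :
    Tendsto (fun n => conc f κ n * (1 - inner ℝ (θ n : EuclideanSpace ℝ (Fin (k + 2)))
      (θ₀ : EuclideanSpace ℝ (Fin (k + 2))))) atTop (𝓝 0) := by
  have h1 : Tendsto (fun n : ℕ => ‖τ n‖ ^ 2 / 2 * ((n : ℝ))⁻¹) atTop (𝓝 (‖τlim‖ ^ 2 / 2 * 0)) :=
    ((h.tendsto_dir.norm.pow 2).div_const 2).mul tendsto_inv_atTop_nhds_zero_nat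
  rw [mul_zero] at h1
  refine h1.congr' ?_
  filter_upwards [h.eventually_sqrt_mul_rate, h.tendsto_conc.eventually_gt_atTop 0,
    eventually_gt_atTop 0] with n hr ha hn
  have hn' : (0 : ℝ) < n := Nat.cast_pos.2 hn
  have e1 := norm_sub_sq_sph (θ n) θ₀
  have e2 : ‖(θ n : EuclideanSpace ℝ (Fin (k + 2))) - θ₀‖ ^ 2 = rate f κ n ^ 2 * ‖τ n‖ ^ 2 := by
    rw [h.loc_eq n, add_sub_cancel_left, norm_smul, mul_pow, Real.norm_eq_abs, sq_abs]
  have e3 : (n * conc f κ n) * rate f κ n ^ 2 = 1 := by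
    rw [← Real.sq_sqrt (mul_pos hn' ha).le, ← mul_pow, hr, one_pow]
  rw [e2] at e1
  have e4 : 1 - inner ℝ (θ n : EuclideanSpace ℝ (Fin (k + 2)))
      (θ₀ : EuclideanSpace ℝ (Fin (k + 2))) = rate f κ n ^ 2 * ‖τ n‖ ^ 2 / 2 := by linarith
  rw [e4]
  field_simp
  linear_combination -(‖τ n‖ ^ 2) * e3

lemma tendsto_conc_rpow_mul_moment (h : LocalSequence f κ τ τlim θ₀ θ) {η : ℝ} (hη : 0 ≤ η) :
    Tendsto (fun n => conc f κ n ^ η * ∫ x : Sph (k + 2),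
      (1 - inner ℝ (x : EuclideanSpace ℝ (Fin (k + 2)))
        (θ n : EuclideanSpace ℝ (Fin (k + 2)))) ^ η ∂rot (k + 2) (θ n) (κ n) f) atTop
      (𝓝 (Real.Gamma (((k : ℝ) - 1) / 2 + η + 1) / Real.Gamma (((k : ℝ) - 1) / 2 + 1))) :=
  tendsto_moment h.angular h.tendsto_kappa θ h.prob hη

lemma integral_one_sub {Ω : Type*} [MeasurableSpace Ω] {μ : Measure Ω} [IsProbabilityMeasure μ]
    {g : Ω → ℝ} (hg : Integrable g μ) : ∫ x, (1 - g x) ∂μ = 1 - ∫ x, g x ∂μ := by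
  rw [integral_sub (integrable_const _) hg]
  simp

lemma tendsto_moment_one (h : LocalSequence f κ τ τlim θ₀ θ) :
    Tendsto (fun n => conc f κ n * ∫ x : Sph (k + 2),
      (1 - inner ℝ (x : EuclideanSpace ℝ (Fin (k + 2)))
        (θ n : EuclideanSpace ℝ (Fin (k + 2)))) ∂rot (k + 2) (θ n) (κ n) f) atTop
      (𝓝 (((k : ℝ) + 1) / 2)) := by
  have h1 := h.tendsto_conc_rpow_mul_moment zero_le_one
  have hk : (0 : ℝ) ≤ k := Nat.cast_nonneg k
  have hξ : 0 < ((k : ℝ) - 1) / 2 + 1 := by linarith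
  rw [Real.Gamma_add_one hξ.ne', mul_div_cancel_right₀ _ (Real.Gamma_pos_of_pos hξ).ne'] at h1
  simp only [Real.rpow_one] at h1
  rwa [show ((k : ℝ) - 1) / 2 + 1 = ((k : ℝ) + 1) / 2 by ring] at h1

lemma exists_tendsto_moment_two (h : LocalSequence f κ τ τlim θ₀ θ) :
    ∃ c : ℝ, Tendsto (fun n => conc f κ n ^ 2 * ∫ x : Sph (k + 2),
      (1 - inner ℝ (x : EuclideanSpace ℝ (Fin (k + 2)))
        (θ n : EuclideanSpace ℝ (Fin (k + 2)))) ^ 2 ∂rot (k + 2) (θ n) (κ n) f) atTop (𝓝 c) := by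
  have h1 := h.tendsto_conc_rpow_mul_moment zero_le_two
  refine ⟨_, h1.congr fun n => ?_⟩
  simp only [Real.rpow_two]

lemma tendsto_conc_mul_moment_two (h : LocalSequence f κ τ τlim θ₀ θ) :
    Tendsto (fun n => conc f κ n * ∫ x : Sph (k + 2),
      (1 - inner ℝ (x : EuclideanSpace ℝ (Fin (k + 2)))
        (θ n : EuclideanSpace ℝ (Fin (k + 2)))) ^ 2 ∂rot (k + 2) (θ n) (κ n) f) atTop (𝓝 0) := by
  obtain ⟨c, hc⟩ := h.exists_tendsto_moment_two
  have h1 := (tendsto_inv_atTop_zero.comp h.tendsto_conc).mul hc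
  rw [zero_mul] at h1
  refine h1.congr' ?_
  filter_upwards [h.tendsto_conc.eventually_gt_atTop 0] with n ha
  simp only [Function.comp_apply]
  field_simp

/-- From `1 - s² = 2 (1 - s) - (1 - s)²`, where the last term is of smaller order. The limit is the
dimension of the tangent space, hence unit variance per rescaled tangential coordinate. -/
lemma tendsto_conc_mul_one_sub_sq (h : LocalSequence f κ τ τlim θ₀ θ) :
    Tendsto (fun n => conc f κ n * ∫ x : Sph (k + 2),
      (1 - inner ℝ (x : EuclideanSpace ℝ (Fin (k + 2)))
        (θ n : EuclideanSpace ℝ (Fin (k + 2))) ^ 2) ∂rot (k + 2) (θ n) (κ n) f) atTop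
      (𝓝 ((k : ℝ) + 1)) := by
  have h1 := (h.tendsto_moment_one.const_mul 2).sub h.tendsto_conc_mul_moment_two
  rw [mul_div_cancel₀ _ two_ne_zero, sub_zero] at h1
  refine h1.congr' ?_
  filter_upwards [h.prob] with n hn
  have : ∀ x : Sph (k + 2), 1 - inner ℝ (x : EuclideanSpace ℝ (Fin (k + 2)))
        (θ n : EuclideanSpace ℝ (Fin (k + 2))) ^ 2
      = 2 * (1 - inner ℝ (x : EuclideanSpace ℝ (Fin (k + 2)))
        (θ n : EuclideanSpace ℝ (Fin (k + 2)))) - (1 - inner ℝ (x : EuclideanSpace ℝ (Fin (k + 2)))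
        (θ n : EuclideanSpace ℝ (Fin (k + 2)))) ^ 2 := fun x => by ring
  have e : ∫ x : Sph (k + 2), (1 - inner ℝ (x : EuclideanSpace ℝ (Fin (k + 2)))
        (θ n : EuclideanSpace ℝ (Fin (k + 2))) ^ 2) ∂rot (k + 2) (θ n) (κ n) f
      = 2 * (∫ x : Sph (k + 2), (1 - inner ℝ (x : EuclideanSpace ℝ (Fin (k + 2)))
          (θ n : EuclideanSpace ℝ (Fin (k + 2)))) ∂rot (k + 2) (θ n) (κ n) f)
        - ∫ x : Sph (k + 2), (1 - inner ℝ (x : EuclideanSpace ℝ (Fin (k + 2)))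
          (θ n : EuclideanSpace ℝ (Fin (k + 2)))) ^ 2 ∂rot (k + 2) (θ n) (κ n) f := by
    simp_rw [this]
    rw [integral_sub (integrable_of_continuous _ (by fun_prop))
      (integrable_of_continuous _ (by fun_prop)), integral_const_mul]
  rw [e]
  ring

/-- Centring at `θ` makes the coefficient of `(θ'w)²` the second moment of `1 - x'θ`, which is of
order `a⁻²`, instead of that of `x'θ`, which is not small. -/
lemma integral_sq_inner_sub {θ : Sph (k + 2)} {κ : ℝ} (hf : AngularClass f)
    [IsProbabilityMeasure (rot (k + 2) θ κ f)] (w : EuclideanSpace ℝ (Fin (k + 2))) :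
    ∫ x : Sph (k + 2), inner ℝ ((x : EuclideanSpace ℝ (Fin (k + 2))) - θ) w ^ 2
        ∂rot (k + 2) θ κ f
      = (‖w‖ ^ 2 - inner ℝ (θ : EuclideanSpace ℝ (Fin (k + 2))) w ^ 2) *
        (∫ x : Sph (k + 2), (1 - inner ℝ (x : EuclideanSpace ℝ (Fin (k + 2)))
          (θ : EuclideanSpace ℝ (Fin (k + 2))) ^ 2) ∂rot (k + 2) θ κ f) / (k + 1)
        + inner ℝ (θ : EuclideanSpace ℝ (Fin (k + 2))) w ^ 2 *
        ∫ x : Sph (k + 2), (1 - inner ℝ (x : EuclideanSpace ℝ (Fin (k + 2)))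
          (θ : EuclideanSpace ℝ (Fin (k + 2)))) ^ 2 ∂rot (k + 2) θ κ f := by
  set c : ℝ := inner ℝ (θ : EuclideanSpace ℝ (Fin (k + 2))) w with hc
  have e1 : ∀ x : Sph (k + 2), inner ℝ ((x : EuclideanSpace ℝ (Fin (k + 2))) - θ) w ^ 2
      = inner ℝ (x : EuclideanSpace ℝ (Fin (k + 2))) w ^ 2
        - (2 * c) * inner ℝ (x : EuclideanSpace ℝ (Fin (k + 2))) w + c ^ 2 := by
    intro x
    rw [inner_sub_left, ← hc]
    ring
  have e2 : ∀ x : Sph (k + 2), (1 - inner ℝ (x : EuclideanSpace ℝ (Fin (k + 2)))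
          (θ : EuclideanSpace ℝ (Fin (k + 2)))) ^ 2
      = inner ℝ (x : EuclideanSpace ℝ (Fin (k + 2)))
          (θ : EuclideanSpace ℝ (Fin (k + 2))) ^ 2
        - 2 * inner ℝ (x : EuclideanSpace ℝ (Fin (k + 2)))
          (θ : EuclideanSpace ℝ (Fin (k + 2))) + 1 := fun x => by ring
  have i1 : ∫ x : Sph (k + 2), inner ℝ ((x : EuclideanSpace ℝ (Fin (k + 2))) - θ) w ^ 2
        ∂rot (k + 2) θ κ f
      = (∫ x : Sph (k + 2), inner ℝ (x : EuclideanSpace ℝ (Fin (k + 2))) w ^ 2 ∂rot (k + 2) θ κ f)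
        - (2 * c) * (∫ x : Sph (k + 2), inner ℝ (x : EuclideanSpace ℝ (Fin (k + 2))) w
          ∂rot (k + 2) θ κ f) + c ^ 2 := by
    simp_rw [e1]
    rw [integral_add (integrable_of_continuous _ (by fun_prop)) (integrable_const _),
      integral_sub (integrable_of_continuous _ (by fun_prop))
        (integrable_of_continuous _ (by fun_prop)), integral_const_mul]
    simp
  have i2 : ∫ x : Sph (k + 2), (1 - inner ℝ (x : EuclideanSpace ℝ (Fin (k + 2)))
          (θ : EuclideanSpace ℝ (Fin (k + 2)))) ^ 2 ∂rot (k + 2) θ κ f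
      = (∫ x : Sph (k + 2), inner ℝ (x : EuclideanSpace ℝ (Fin (k + 2)))
          (θ : EuclideanSpace ℝ (Fin (k + 2))) ^ 2 ∂rot (k + 2) θ κ f)
        - 2 * (∫ x : Sph (k + 2), inner ℝ (x : EuclideanSpace ℝ (Fin (k + 2)))
          (θ : EuclideanSpace ℝ (Fin (k + 2))) ∂rot (k + 2) θ κ f) + 1 := by
    simp_rw [e2]
    rw [integral_add (integrable_of_continuous _ (by fun_prop)) (integrable_const _),
      integral_sub (integrable_of_continuous _ (by fun_prop))
        (integrable_of_continuous _ (by fun_prop)), integral_const_mul]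
    simp
  rw [i1, i2, integral_rot_inner θ κ hf, integral_rot_inner_sq θ κ hf, ← hc]
  ring

/-- Centring at `θ n` instead of the true mean costs `-(θ_n'w) E[1 - x'θ_n]` per observation. Since
`√(n a_n) θ_n'w = τ_n'w` stays bounded, the total is of order `1/a_n`. -/
lemma tendsto_mean (h : LocalSequence f κ τ τlim θ₀ θ) {w : EuclideanSpace ℝ (Fin (k + 2))}
    (hw : inner ℝ (θ₀ : EuclideanSpace ℝ (Fin (k + 2))) w = 0) :
    Tendsto (fun n : ℕ => n * ∫ x : Sph (k + 2), √(conc f κ n / n) *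
      inner ℝ ((x : EuclideanSpace ℝ (Fin (k + 2))) - θ n) w ∂rot (k + 2) (θ n) (κ n) f)
      atTop (𝓝 0) := by
  have hτw : Tendsto (fun n => inner ℝ (τ n) w) atTop (𝓝 (inner ℝ τlim w)) :=
    h.tendsto_dir.inner tendsto_const_nhds
  have h1 := (hτw.mul h.tendsto_moment_one).mul (tendsto_inv_atTop_zero.comp h.tendsto_conc)
  rw [mul_zero] at h1
  have h2 := h1.neg
  rw [neg_zero] at h2
  refine h2.congr' ?_
  filter_upwards [h.prob, h.eventually_sqrt_mul_inner hw, h.tendsto_conc.eventually_gt_atTop 0,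
    eventually_gt_atTop 0] with n hP hn ha hn0
  have hn' : (0 : ℝ) < n := Nat.cast_pos.2 hn0
  have e1 : (n : ℝ) * √(conc f κ n / n) = √(n * conc f κ n) := by
    rw [show (n : ℝ) * conc f κ n = n ^ 2 * (conc f κ n / n) by field_simp,
      Real.sqrt_mul (by positivity), Real.sqrt_sq hn'.le]
  have e2 : ∫ x : Sph (k + 2), inner ℝ ((x : EuclideanSpace ℝ (Fin (k + 2))) - θ n) w
      ∂rot (k + 2) (θ n) (κ n) f = -inner ℝ (θ n : EuclideanSpace ℝ (Fin (k + 2))) w *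
        ∫ x : Sph (k + 2), (1 - inner ℝ (x : EuclideanSpace ℝ (Fin (k + 2)))
          (θ n : EuclideanSpace ℝ (Fin (k + 2)))) ∂rot (k + 2) (θ n) (κ n) f := by
    simp_rw [inner_sub_left]
    rw [integral_sub (integrable_of_continuous _ (by fun_prop)) (integrable_const _),
      integral_one_sub (integrable_of_continuous _ (by fun_prop)),
      integral_rot_inner _ _ h.angular]
    simp
    ring
  rw [integral_const_mul, ← mul_assoc (n : ℝ), e1, e2, ← hn]
  simp only [Function.comp_apply]
  field_simp

lemma tendsto_second_moment (h : LocalSequence f κ τ τlim θ₀ θ)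
    {w : EuclideanSpace ℝ (Fin (k + 2))}
    (hw : inner ℝ (θ₀ : EuclideanSpace ℝ (Fin (k + 2))) w = 0) :
    Tendsto (fun n : ℕ => n * ∫ x : Sph (k + 2), (√(conc f κ n / n) *
      inner ℝ ((x : EuclideanSpace ℝ (Fin (k + 2))) - θ n) w) ^ 2 ∂rot (k + 2) (θ n) (κ n) f)
      atTop (𝓝 (‖w‖ ^ 2)) := by
  have hk : (0 : ℝ) < (k : ℝ) + 1 := by positivity
  have hc : Tendsto (fun n => inner ℝ (θ n : EuclideanSpace ℝ (Fin (k + 2))) w) atTop (𝓝 0) := by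
    have := h.tendsto_loc.inner (𝕜 := ℝ) (tendsto_const_nhds (x := w))
    rwa [hw] at this
  have h1 := ((((tendsto_const_nhds (x := ‖w‖ ^ 2)).sub (hc.pow 2)).mul
    h.tendsto_conc_mul_one_sub_sq).div_const ((k : ℝ) + 1)).add
    ((hc.pow 2).mul h.tendsto_conc_mul_moment_two)
  rw [mul_zero, add_zero, mul_div_cancel_right₀ _ hk.ne', zero_pow two_ne_zero, sub_zero] at h1
  refine h1.congr' ?_
  filter_upwards [h.prob, h.tendsto_conc.eventually_gt_atTop 0,
    eventually_gt_atTop 0] with n hP ha hn0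
  have hn' : (0 : ℝ) < n := Nat.cast_pos.2 hn0
  simp_rw [mul_pow]
  rw [integral_const_mul, Real.sq_sqrt (by positivity), integral_sq_inner_sub h.angular]
  field_simp

lemma norm_sub_eq_sqrt_mul_rpow {p : ℕ} (x y : Sph p) :
    ‖(x : EuclideanSpace ℝ (Fin p)) - y‖ = √2 * (1 - inner ℝ (x : EuclideanSpace ℝ (Fin p))
      (y : EuclideanSpace ℝ (Fin p))) ^ (1 / 2 : ℝ) := by
  rw [← Real.sqrt_eq_rpow, ← Real.sqrt_mul zero_le_two, ← norm_sub_sq_sph,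
    Real.sqrt_sq (norm_nonneg _)]

/-- Lyapunov's condition: `|(x - θ)'w| ≤ √2 ‖w‖ u^(1/2)` with `u = 1 - x'θ`, and `a^(3/2) E u^(3/2)`
converges, which leaves a factor `n^(-1/2)`. -/
lemma tendsto_third_moment (h : LocalSequence f κ τ τlim θ₀ θ)
    (w : EuclideanSpace ℝ (Fin (k + 2))) :
    Tendsto (fun n : ℕ => n * ∫ x : Sph (k + 2), |√(conc f κ n / n) *
      inner ℝ ((x : EuclideanSpace ℝ (Fin (k + 2))) - θ n) w| ^ 3 ∂rot (k + 2) (θ n) (κ n) f)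
      atTop (𝓝 0) := by
  have h1 := h.tendsto_conc_rpow_mul_moment (η := 3 / 2) (by norm_num)
  have h2 : Tendsto (fun n : ℕ => (√(n : ℝ))⁻¹) atTop (𝓝 0) :=
    tendsto_inv_atTop_zero.comp (Real.tendsto_sqrt_atTop.comp tendsto_natCast_atTop_atTop)
  have h3 := (h2.mul h1).const_mul ((√2 * ‖w‖) ^ 3)
  rw [zero_mul, mul_zero] at h3
  refine squeeze_zero' (Eventually.of_forall fun n => ?_) ?_ h3
  · exact mul_nonneg (Nat.cast_nonneg _) (integral_nonneg fun x => by positivity)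
  filter_upwards [h.prob, h.tendsto_conc.eventually_gt_atTop 0,
    eventually_gt_atTop 0] with n hP ha hn0
  have hn' : (0 : ℝ) < n := Nat.cast_pos.2 hn0
  have hb : ∀ x : Sph (k + 2), |√(conc f κ n / n) *
      inner ℝ ((x : EuclideanSpace ℝ (Fin (k + 2))) - θ n) w| ^ 3
      ≤ (√(conc f κ n / n) ^ 3 * (√2 * ‖w‖) ^ 3) *
        (1 - inner ℝ (x : EuclideanSpace ℝ (Fin (k + 2)))
          (θ n : EuclideanSpace ℝ (Fin (k + 2)))) ^ (3 / 2 : ℝ) := by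
    intro x
    have hu : 0 ≤ 1 - inner ℝ (x : EuclideanSpace ℝ (Fin (k + 2)))
          (θ n : EuclideanSpace ℝ (Fin (k + 2))) := by linarith [inner_sph_le_one x (θ n)]
    have e : (1 - inner ℝ (x : EuclideanSpace ℝ (Fin (k + 2)))
          (θ n : EuclideanSpace ℝ (Fin (k + 2)))) ^ (3 / 2 : ℝ)
        = ((1 - inner ℝ (x : EuclideanSpace ℝ (Fin (k + 2)))
          (θ n : EuclideanSpace ℝ (Fin (k + 2)))) ^ (1 / 2 : ℝ)) ^ 3 := by
      rw [← Real.rpow_natCast, ← Real.rpow_mul hu]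
      norm_num
    rw [e, ← mul_pow, ← mul_pow]
    refine pow_le_pow_left₀ (abs_nonneg _) ?_ 3
    rw [abs_mul, abs_of_nonneg (Real.sqrt_nonneg _), mul_assoc]
    refine mul_le_mul_of_nonneg_left ?_ (Real.sqrt_nonneg _)
    refine (abs_real_inner_le_norm _ _).trans (le_of_eq ?_)
    rw [norm_sub_eq_sqrt_mul_rpow]
    ring
  have hi : ∫ x : Sph (k + 2), |√(conc f κ n / n) *
      inner ℝ ((x : EuclideanSpace ℝ (Fin (k + 2))) - θ n) w| ^ 3 ∂rot (k + 2) (θ n) (κ n) f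
      ≤ (√(conc f κ n / n) ^ 3 * (√2 * ‖w‖) ^ 3) * ∫ x : Sph (k + 2),
        (1 - inner ℝ (x : EuclideanSpace ℝ (Fin (k + 2)))
          (θ n : EuclideanSpace ℝ (Fin (k + 2)))) ^ (3 / 2 : ℝ) ∂rot (k + 2) (θ n) (κ n) f := by
    rw [← integral_const_mul]
    refine integral_mono (integrable_of_continuous _ (by fun_prop))
      (integrable_of_continuous _ ?_) hb
    exact continuous_const.mul (Continuous.rpow_const (by fun_prop) fun _ => Or.inr (by norm_num))
  refine (mul_le_mul_of_nonneg_left hi hn'.le).trans (le_of_eq ?_)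
  have e3 : (n : ℝ) * √(conc f κ n / n) ^ 3
      = (√(n : ℝ))⁻¹ * conc f κ n ^ (3 / 2 : ℝ) := by
    have hs : √(n : ℝ) ≠ 0 := (Real.sqrt_pos.2 hn').ne'
    have e4 : conc f κ n ^ (3 / 2 : ℝ) = √(conc f κ n) ^ 3 := by
      rw [Real.sqrt_eq_rpow, ← Real.rpow_natCast, ← Real.rpow_mul ha.le]
      norm_num
    rw [e4, Real.sqrt_div ha.le, div_pow]
    field_simp
    exact (Real.sq_sqrt hn'.le).symm
  linear_combination ((√2 * ‖w‖) ^ 3 * ∫ x : Sph (k + 2),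
        (1 - inner ℝ (x : EuclideanSpace ℝ (Fin (k + 2)))
          (θ n : EuclideanSpace ℝ (Fin (k + 2)))) ^ (3 / 2 : ℝ) ∂rot (k + 2) (θ n) (κ n) f) * e3

lemma tendsto_integral_exp_pow (h : LocalSequence f κ τ τlim θ₀ θ)
    {w : EuclideanSpace ℝ (Fin (k + 2))}
    (hw : inner ℝ (θ₀ : EuclideanSpace ℝ (Fin (k + 2))) w = 0) :
    Tendsto (fun n : ℕ => (∫ x : Sph (k + 2), Complex.exp ((√(conc f κ n / n) *
      inner ℝ ((x : EuclideanSpace ℝ (Fin (k + 2))) - θ n) w : ℝ) * Complex.I)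
        ∂rot (k + 2) (θ n) (κ n) f) ^ n) atTop (𝓝 (Complex.exp (-(‖w‖ ^ 2 / 2 : ℝ)))) := by
  refine HighConc.tendsto_integral_exp_pow h.prob ?_ ?_ ?_ (h.tendsto_mean hw)
    (h.tendsto_second_moment hw) (h.tendsto_third_moment w)
  all_goals
    filter_upwards [h.prob] with n hP
    exact integrable_of_continuous _ (by fun_prop)

/-- Replacing `θ n` by `θ₀` is harmless: with `c = θ_n'θ₀` and `m = E[1 - (x'θ_n)²]`, the integral
is `(1 - c²)(1 - m/(k+1)) + c² m`, and `a_n (1 - c²) → 0`. -/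
lemma tendsto_conc_mul_integral_denom (h : LocalSequence f κ τ τlim θ₀ θ) :
    Tendsto (fun n => conc f κ n * ∫ x : Sph (k + 2),
      (1 - inner ℝ (x : EuclideanSpace ℝ (Fin (k + 2)))
        (θ₀ : EuclideanSpace ℝ (Fin (k + 2))) ^ 2) ∂rot (k + 2) (θ n) (κ n) f) atTop
      (𝓝 ((k : ℝ) + 1)) := by
  have hc : Tendsto (fun n => inner ℝ (θ n : EuclideanSpace ℝ (Fin (k + 2)))
      (θ₀ : EuclideanSpace ℝ (Fin (k + 2)))) atTop (𝓝 1) := by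
    have := h.tendsto_loc.inner (𝕜 := ℝ) (tendsto_const_nhds (x := (θ₀ : EuclideanSpace ℝ (Fin (k + 2)))))
    rwa [real_inner_self_eq_norm_sq, norm_eq_of_mem_sphere, one_pow] at this
  have he := h.tendsto_conc_mul_one_sub_sq
  have h0 := h.tendsto_conc_mul_one_sub_inner.mul (hc.const_add 1)
  rw [zero_mul] at h0
  have h1 : Tendsto (fun n => (∫ x : Sph (k + 2),
      (1 - inner ℝ (x : EuclideanSpace ℝ (Fin (k + 2)))
        (θ n : EuclideanSpace ℝ (Fin (k + 2))) ^ 2) ∂rot (k + 2) (θ n) (κ n) f)) atTop (𝓝 0) := by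
    have := (tendsto_inv_atTop_zero.comp h.tendsto_conc).mul he
    rw [zero_mul] at this
    refine this.congr' ?_
    filter_upwards [h.tendsto_conc.eventually_gt_atTop 0] with n ha
    simp only [Function.comp_apply]
    field_simp
  have h2 := (h0.mul ((h1.div_const ((k : ℝ) + 1)).const_sub 1)).add ((hc.pow 2).mul he)
  simp only [zero_mul, one_pow, one_mul, zero_add] at h2
  refine h2.congr' ?_
  filter_upwards [h.prob] with n hP
  have e1 : ∫ x : Sph (k + 2), (1 - inner ℝ (x : EuclideanSpace ℝ (Fin (k + 2)))
        (θ n : EuclideanSpace ℝ (Fin (k + 2))) ^ 2) ∂rot (k + 2) (θ n) (κ n) f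
      = 1 - ∫ x : Sph (k + 2), inner ℝ (x : EuclideanSpace ℝ (Fin (k + 2)))
        (θ n : EuclideanSpace ℝ (Fin (k + 2))) ^ 2 ∂rot (k + 2) (θ n) (κ n) f :=
    integral_one_sub (integrable_of_continuous _ (by fun_prop))
  have e2 : ∫ x : Sph (k + 2), (1 - inner ℝ (x : EuclideanSpace ℝ (Fin (k + 2)))
        (θ₀ : EuclideanSpace ℝ (Fin (k + 2))) ^ 2) ∂rot (k + 2) (θ n) (κ n) f
      = 1 - ∫ x : Sph (k + 2), inner ℝ (x : EuclideanSpace ℝ (Fin (k + 2)))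
        (θ₀ : EuclideanSpace ℝ (Fin (k + 2))) ^ 2 ∂rot (k + 2) (θ n) (κ n) f :=
    integral_one_sub (integrable_of_continuous _ (by fun_prop))
  rw [e2, integral_rot_inner_sq _ _ h.angular, e1, norm_eq_of_mem_sphere]
  ring

lemma tendsto_denom_second_moment (h : LocalSequence f κ τ τlim θ₀ θ) :
    Tendsto (fun n : ℕ => conc f κ n ^ 2 / n * ∫ x : Sph (k + 2),
      (1 - inner ℝ (x : EuclideanSpace ℝ (Fin (k + 2)))
        (θ₀ : EuclideanSpace ℝ (Fin (k + 2))) ^ 2) ^ 2 ∂rot (k + 2) (θ n) (κ n) f) atTop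
      (𝓝 0) := by
  obtain ⟨c, hc⟩ := h.exists_tendsto_moment_two
  have h1 := ((hc.const_mul 32).add ((h.tendsto_conc_mul_one_sub_inner.pow 2).const_mul 32)).mul
    (tendsto_inv_atTop_nhds_zero_nat (𝕜 := ℝ))
  rw [mul_zero] at h1
  refine squeeze_zero' (Eventually.of_forall fun n => ?_) ?_ h1
  · exact mul_nonneg (by positivity) (integral_nonneg fun x => by positivity)
  filter_upwards [h.prob] with n hP
  set e : ℝ := 1 - inner ℝ (θ n : EuclideanSpace ℝ (Fin (k + 2)))
      (θ₀ : EuclideanSpace ℝ (Fin (k + 2))) with he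
  -- With `s = x'θ₀` and `u = 1 - x'θ_n`, `1 - s² ≤ 2 (1 - s) = ‖x - θ₀‖² ≤ 2 ‖x - θ_n‖² + 2 ‖θ_n -
  -- θ₀‖² = 4u + 4e`, whose square is at most `32 u² + 32 e²`.
  have hb : ∀ x : Sph (k + 2), (1 - inner ℝ (x : EuclideanSpace ℝ (Fin (k + 2)))
        (θ₀ : EuclideanSpace ℝ (Fin (k + 2))) ^ 2) ^ 2
      ≤ 32 * (1 - inner ℝ (x : EuclideanSpace ℝ (Fin (k + 2)))
        (θ n : EuclideanSpace ℝ (Fin (k + 2)))) ^ 2 + 32 * e ^ 2 := by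
    intro x
    have n1 := norm_sub_sq_sph x θ₀
    have n2 := norm_sub_sq_sph x (θ n)
    have n3 := norm_sub_sq_sph (θ n) θ₀
    have n4 := norm_sub_le_norm_sub_add_norm_sub (x : EuclideanSpace ℝ (Fin (k + 2))) (θ n) θ₀
    have n5 : ‖(x : EuclideanSpace ℝ (Fin (k + 2))) - θ₀‖ ^ 2 ≤
        2 * ‖(x : EuclideanSpace ℝ (Fin (k + 2))) - θ n‖ ^ 2
        + 2 * ‖(θ n : EuclideanSpace ℝ (Fin (k + 2))) - θ₀‖ ^ 2 := by
      refine (pow_le_pow_left₀ (norm_nonneg _) n4 2).trans ?_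
      nlinarith [sq_nonneg (‖(x : EuclideanSpace ℝ (Fin (k + 2))) - θ n‖
        - ‖(θ n : EuclideanSpace ℝ (Fin (k + 2))) - θ₀‖)]
    rw [n1, n2, n3, ← he] at n5
    have i1 := inner_sph_le_one x θ₀
    have i2 := neg_one_le_inner_sph x θ₀
    set s : ℝ := inner ℝ (x : EuclideanSpace ℝ (Fin (k + 2)))
      (θ₀ : EuclideanSpace ℝ (Fin (k + 2)))
    set u : ℝ := 1 - inner ℝ (x : EuclideanSpace ℝ (Fin (k + 2)))
      (θ n : EuclideanSpace ℝ (Fin (k + 2)))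
    have j1 : 0 ≤ 1 - s ^ 2 := by nlinarith
    have j2 : 1 - s ^ 2 ≤ 4 * u + 4 * e := by nlinarith
    refine (pow_le_pow_left₀ j1 j2 2).trans ?_
    nlinarith [sq_nonneg (u - e)]
  have hi : ∫ x : Sph (k + 2), (1 - inner ℝ (x : EuclideanSpace ℝ (Fin (k + 2)))
        (θ₀ : EuclideanSpace ℝ (Fin (k + 2))) ^ 2) ^ 2 ∂rot (k + 2) (θ n) (κ n) f
      ≤ 32 * (∫ x : Sph (k + 2), (1 - inner ℝ (x : EuclideanSpace ℝ (Fin (k + 2)))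
        (θ n : EuclideanSpace ℝ (Fin (k + 2)))) ^ 2 ∂rot (k + 2) (θ n) (κ n) f)
        + 32 * e ^ 2 := by
    refine (integral_mono (integrable_of_continuous _ (by fun_prop))
      (integrable_of_continuous _ (by fun_prop)) hb).trans (le_of_eq ?_)
    rw [integral_add (integrable_of_continuous _ (by fun_prop)) (integrable_const _),
      integral_const_mul]
    simp
  refine (mul_le_mul_of_nonneg_left hi (by positivity)).trans (le_of_eq ?_)
  ring

lemma tendsto_integral_norm_sub (h : LocalSequence f κ τ τlim θ₀ θ) :
    Tendsto (fun n => ∫ x : Sph (k + 2), ‖(x : EuclideanSpace ℝ (Fin (k + 2))) - θ n‖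
      ∂rot (k + 2) (θ n) (κ n) f) atTop (𝓝 0) := by
  have h1 := h.tendsto_conc_rpow_mul_moment (η := 1 / 2) (by norm_num)
  have h2 : Tendsto (fun n => conc f κ n ^ (1 / 2 : ℝ)) atTop atTop :=
    (tendsto_rpow_atTop (by norm_num)).comp h.tendsto_conc
  have h3 := ((tendsto_inv_atTop_zero.comp h2).mul h1).const_mul √2
  rw [zero_mul, mul_zero] at h3
  refine h3.congr' ?_
  filter_upwards [h2.eventually_gt_atTop 0] with n hn
  simp_rw [norm_sub_eq_sqrt_mul_rpow]
  rw [integral_const_mul]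
  simp only [Function.comp_apply]
  rw [inv_mul_cancel_left₀ hn.ne']

end LocalSequence

end HighConc

-- Sample quantities: measurability, expectations and variance

namespace HighConc

section Sample

variable {p n : ℕ} {Ω : Type*} [MeasurableSpace Ω] {P : Measure Ω}
  {X : Fin n → Ω → Sph p} {θ : Sph p} {κ : ℝ} {f : ℝ → ℝ}

@[fun_prop]
lemma continuous_sampleMean : Continuous (sampleMean : (Fin n → Sph p) → _) := by
  unfold sampleMean
  fun_prop

@[fun_prop]
lemma continuous_testDenom (θ₀ : Sph p) : Continuous (testDenom θ₀ : (Fin n → Sph p) → ℝ) := by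
  unfold testDenom
  fun_prop

lemma continuous_tangentForm (θ₀ : Sph p) : Continuous (tangentForm θ₀) := by
  unfold tangentForm
  fun_prop

lemma measurable_watson (θ₀ : Sph p) : Measurable (watson θ₀ : (Fin n → Sph p) → ℝ) := by
  have := (continuous_tangentForm θ₀).measurable
  have h1 : Measurable (sampleMean : (Fin n → Sph p) → _) := continuous_sampleMean.measurable
  have h2 : Measurable (testDenom θ₀ : (Fin n → Sph p) → ℝ) := (continuous_testDenom θ₀).measurable
  unfold watson
  fun_prop

lemma measurable_wald (θ₀ : Sph p) : Measurable (wald θ₀ : (Fin n → Sph p) → ℝ) := by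
  have := (continuous_tangentForm θ₀).measurable
  have h1 : Measurable (sampleMean : (Fin n → Sph p) → _) := continuous_sampleMean.measurable
  have h2 : Measurable (testDenom θ₀ : (Fin n → Sph p) → ℝ) := (continuous_testDenom θ₀).measurable
  unfold wald sphericalMean
  fun_prop

namespace IsRotSample

lemma aemeasurable_pi (hX : IsRotSample P X θ κ f) :
    AEMeasurable (fun ω i => X i ω) P :=
  _root_.aemeasurable_pi_lambda _ fun i => (hX.hasLaw i).aemeasurable

lemma memLp_comp [IsFiniteMeasure P] (hX : IsRotSample P X θ κ f) {E : Type*}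
    [NormedAddCommGroup E] [SecondCountableTopology E] [MeasurableSpace E] [BorelSpace E]
    {G : (Fin n → Sph p) → E} (hG : Continuous G) (q : ENNReal) :
    MemLp (fun ω => G fun i => X i ω) q P := by
  obtain ⟨C, hC⟩ := isCompact_univ.exists_bound_of_continuousOn hG.continuousOn
  exact MemLp.of_bound (hG.measurable.comp_aemeasurable hX.aemeasurable_pi).aestronglyMeasurable C
    (ae_of_all _ fun ω => hC _ (mem_univ _))

lemma integral_comp (hX : IsRotSample P X θ κ f) {E : Type*}
    [NormedAddCommGroup E] [NormedSpace ℝ E] [SecondCountableTopology E]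
    [MeasurableSpace E] [BorelSpace E] {g : Sph p → E}
    (hg : Continuous g) (i : Fin n) : ∫ ω, g (X i ω) ∂P = ∫ x, g x ∂rot p θ κ f :=
  (hX.hasLaw i).integral_comp hg.measurable.aestronglyMeasurable

lemma integral_exp_sum (hX : IsRotSample P X θ κ f) {g : Sph p → ℝ} (hg : Continuous g) :
    ∫ ω, Complex.exp ((∑ i, g (X i ω) : ℝ) * Complex.I) ∂P
      = (∫ x, Complex.exp (g x * Complex.I) ∂rot p θ κ f) ^ n := by
  have hm : ∀ i, AEMeasurable (fun ω => g (X i ω)) P := fun i =>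
    hg.measurable.comp_aemeasurable (hX.hasLaw i).aemeasurable
  have hind : iIndepFun (fun i ω => g (X i ω)) P :=
    hX.indep.comp (fun _ => g) fun _ => hg.measurable
  have h := hind.charFun_map_fun_sum_eq_prod hm
  -- Frequency `1` suffices, since any frequency can be absorbed into `g`.
  have h1 := congrFun h 1
  rw [charFun_apply_real, integral_map (Finset.aemeasurable_fun_sum _ fun i _ => hm i)
    (by fun_prop)] at h1
  simp only [Complex.ofReal_one, one_mul, Finset.prod_apply] at h1
  rw [h1]
  have h2 : ∀ i, charFun (P.map fun ω => g (X i ω)) 1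
      = ∫ x, Complex.exp (g x * Complex.I) ∂rot p θ κ f := by
    intro i
    rw [charFun_apply_real, integral_map (hm i) (by fun_prop)]
    simp only [Complex.ofReal_one, one_mul]
    exact hX.integral_comp (g := fun x => Complex.exp (g x * Complex.I)) (by fun_prop) i
  simp [h2]

lemma testDenom_eq_sum (hn : n ≠ 0) (θ₀ : Sph p) (x : Fin n → Sph p) :
    testDenom θ₀ x = ∑ i, (n : ℝ)⁻¹ * (1 - inner ℝ (x i : EuclideanSpace ℝ (Fin p))
      (θ₀ : EuclideanSpace ℝ (Fin p)) ^ 2) := by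
  have hn' : (n : ℝ) ≠ 0 := Nat.cast_ne_zero.2 hn
  rw [testDenom, ← Finset.mul_sum, Finset.sum_sub_distrib]
  simp
  field_simp

lemma integral_testDenom [IsProbabilityMeasure P] (hX : IsRotSample P X θ κ f) (hn : n ≠ 0)
    (θ₀ : Sph p) :
    ∫ ω, testDenom θ₀ (fun i => X i ω) ∂P = ∫ x : Sph p,
      (1 - inner ℝ (x : EuclideanSpace ℝ (Fin p)) (θ₀ : EuclideanSpace ℝ (Fin p)) ^ 2)
        ∂rot p θ κ f := by
  have hn' : (n : ℝ) ≠ 0 := Nat.cast_ne_zero.2 hn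
  simp_rw [testDenom_eq_sum hn]
  rw [integral_finsetSum _ fun i _ => (hX.memLp_comp (G := fun x => (n : ℝ)⁻¹ *
    (1 - inner ℝ (x i : EuclideanSpace ℝ (Fin p)) (θ₀ : EuclideanSpace ℝ (Fin p)) ^ 2))
    (by fun_prop) 1).integrable le_rfl]
  have : ∀ i, ∫ ω, (n : ℝ)⁻¹ * (1 - inner ℝ (X i ω : EuclideanSpace ℝ (Fin p))
      (θ₀ : EuclideanSpace ℝ (Fin p)) ^ 2) ∂P = (n : ℝ)⁻¹ * ∫ x : Sph p,
      (1 - inner ℝ (x : EuclideanSpace ℝ (Fin p)) (θ₀ : EuclideanSpace ℝ (Fin p)) ^ 2)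
        ∂rot p θ κ f := by
    intro i
    rw [integral_const_mul, ← hX.integral_comp (g := fun x => 1 - inner ℝ
      (x : EuclideanSpace ℝ (Fin p)) (θ₀ : EuclideanSpace ℝ (Fin p)) ^ 2) (by fun_prop) i]
  simp [this, hn']

lemma variance_testDenom_le [IsProbabilityMeasure P] (hX : IsRotSample P X θ κ f) (hn : n ≠ 0)
    (θ₀ : Sph p) :
    Var[fun ω => testDenom θ₀ (fun i => X i ω); P] ≤ (n : ℝ)⁻¹ * ∫ x : Sph p,
      (1 - inner ℝ (x : EuclideanSpace ℝ (Fin p)) (θ₀ : EuclideanSpace ℝ (Fin p)) ^ 2) ^ 2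
        ∂rot p θ κ f := by
  have hn' : (n : ℝ) ≠ 0 := Nat.cast_ne_zero.2 hn
  set g : Sph p → ℝ := fun x => (n : ℝ)⁻¹ *
    (1 - inner ℝ (x : EuclideanSpace ℝ (Fin p)) (θ₀ : EuclideanSpace ℝ (Fin p)) ^ 2) with hg
  have hgc : Continuous g := by fun_prop
  have e1 : (fun ω => testDenom θ₀ (fun i => X i ω)) = ∑ i, fun ω => g (X i ω) := by
    ext ω
    rw [testDenom_eq_sum hn, Finset.sum_apply]
  have hind : iIndepFun (fun i ω => g (X i ω)) P :=
    hX.indep.comp (fun _ => g) fun _ => hgc.measurable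
  have hL : ∀ i, MemLp (fun ω => g (X i ω)) 2 P := fun i =>
    hX.memLp_comp (G := fun x => g (x i)) (by fun_prop) 2
  rw [e1, IndepFun.variance_sum (fun i _ => hL i) fun i _ j _ hij => hind.indepFun hij]
  have e2 : ∀ i, Var[fun ω => g (X i ω); P] ≤ (n : ℝ)⁻¹ ^ 2 * ∫ x : Sph p,
      (1 - inner ℝ (x : EuclideanSpace ℝ (Fin p)) (θ₀ : EuclideanSpace ℝ (Fin p)) ^ 2) ^ 2
        ∂rot p θ κ f := by
    intro i
    refine (variance_le_expectation_sq (hL i).aestronglyMeasurable).trans (le_of_eq ?_)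
    have := hX.integral_comp (g := fun x => g x ^ 2) (by fun_prop) i
    rw [← integral_const_mul]
    simp_rw [← mul_pow]
    exact this
  refine (Finset.sum_le_sum fun i _ => e2 i).trans (le_of_eq ?_)
  simp
  field_simp

lemma integral_dist_sampleMean_le [IsProbabilityMeasure P] (hX : IsRotSample P X θ κ f)
    (hn : n ≠ 0) (y : EuclideanSpace ℝ (Fin p)) :
    ∫ ω, dist (sampleMean fun i => X i ω) y ∂P ≤
      (∫ x : Sph p, ‖(x : EuclideanSpace ℝ (Fin p)) - θ‖ ∂rot p θ κ f)
        + ‖(θ : EuclideanSpace ℝ (Fin p)) - y‖ := by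
  have hn' : (n : ℝ) ≠ 0 := Nat.cast_ne_zero.2 hn
  have hb : ∀ ω, dist (sampleMean fun i => X i ω) y ≤
      (∑ i, (n : ℝ)⁻¹ * ‖(X i ω : EuclideanSpace ℝ (Fin p)) - θ‖)
        + ‖(θ : EuclideanSpace ℝ (Fin p)) - y‖ := by
    intro ω
    rw [dist_eq_norm]
    refine (norm_sub_le_norm_sub_add_norm_sub _ (θ : EuclideanSpace ℝ (Fin p)) _).trans
      (add_le_add ?_ le_rfl)
    have : (sampleMean fun i => X i ω) - (θ : EuclideanSpace ℝ (Fin p))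
        = (n : ℝ)⁻¹ • ∑ i, ((X i ω : EuclideanSpace ℝ (Fin p)) - θ) := by
      rw [sampleMean, Finset.sum_sub_distrib, smul_sub]
      simp [← Nat.cast_smul_eq_nsmul ℝ, smul_smul, hn']
    rw [this, norm_smul, ← Finset.mul_sum, norm_inv, Real.norm_natCast]
    exact mul_le_mul_of_nonneg_left (norm_sum_le _ _) (by positivity)
  have hi : ∀ i, Integrable (fun ω => (n : ℝ)⁻¹ * ‖(X i ω : EuclideanSpace ℝ (Fin p)) - θ‖) P :=
    fun i => (hX.memLp_comp (G := fun x => (n : ℝ)⁻¹ * ‖(x i : EuclideanSpace ℝ (Fin p)) - θ‖)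
      (by fun_prop) 1).integrable le_rfl
  refine (integral_mono ((hX.memLp_comp (G := fun x => dist (sampleMean x) y)
    (by fun_prop) 1).integrable le_rfl) ((integrable_finsetSum _ fun i _ => hi i).add
      (integrable_const _)) hb).trans (le_of_eq ?_)
  simp only [Pi.add_apply]
  rw [integral_add (integrable_finsetSum _ fun i _ => hi i) (integrable_const _),
    integral_finsetSum _ fun i _ => hi i]
  have : ∀ i, ∫ ω, (n : ℝ)⁻¹ * ‖(X i ω : EuclideanSpace ℝ (Fin p)) - θ‖ ∂P
      = (n : ℝ)⁻¹ * ∫ x : Sph p, ‖(x : EuclideanSpace ℝ (Fin p)) - θ‖ ∂rot p θ κ f := by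
    intro i
    rw [integral_const_mul, ← hX.integral_comp
      (g := fun x => ‖(x : EuclideanSpace ℝ (Fin p)) - θ‖) (by fun_prop) i]
  simp [this, hn']

end IsRotSample

end Sample

-- Tangential coordinates and the Gaussian limit law

lemma tangentForm_eq {p : ℕ} (θ : Sph p) (y : EuclideanSpace ℝ (Fin p)) :
    tangentForm θ y = ‖y‖ ^ 2 - inner ℝ (θ : EuclideanSpace ℝ (Fin p)) y ^ 2 := by
  rw [tangentForm, inner_sub_right, inner_smul_right, real_inner_self_eq_norm_sq,
    real_inner_comm]
  ring

/-- The rescaled coordinates of the sample mean along the non-initial vectors of an orthonormal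
basis. -/
noncomputable def scaledCoords {k n : ℕ}
    (b : OrthonormalBasis (Fin (k + 2)) ℝ (EuclideanSpace ℝ (Fin (k + 2)))) (r : ℝ)
    (x : Fin n → Sph (k + 2)) : EuclideanSpace ℝ (Fin (k + 1)) :=
  WithLp.toLp 2 fun j => r * inner ℝ (sampleMean x) (b j.succ)

lemma continuous_scaledCoords {k n : ℕ}
    (b : OrthonormalBasis (Fin (k + 2)) ℝ (EuclideanSpace ℝ (Fin (k + 2)))) (r : ℝ) :
    Continuous (scaledCoords b r : (Fin n → Sph (k + 2)) → _) := by
  unfold scaledCoords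
  fun_prop

/-- Parseval's identity: removing the coordinate along `b 0 = θ₀` leaves the tangential quadratic
form. -/
lemma norm_scaledCoords_sq {k n : ℕ}
    (b : OrthonormalBasis (Fin (k + 2)) ℝ (EuclideanSpace ℝ (Fin (k + 2)))) (r : ℝ)
    (θ₀ : Sph (k + 2)) (hb : b 0 = θ₀) (x : Fin n → Sph (k + 2)) :
    ‖scaledCoords b r x‖ ^ 2 = r ^ 2 * tangentForm θ₀ (sampleMean x) := by
  have h := b.sum_sq_norm_inner_left (sampleMean x)
  rw [Fin.sum_univ_succ, hb] at h
  simp only [Real.norm_eq_abs, sq_abs] at h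
  rw [tangentForm_eq, ← h, EuclideanSpace.real_norm_sq_eq, real_inner_comm]
  simp [scaledCoords, mul_pow, Finset.mul_sum]

/-- The direction in `ℝ^p` whose non-initial coordinates are `t`. -/
noncomputable def liftDir {k : ℕ}
    (b : OrthonormalBasis (Fin (k + 2)) ℝ (EuclideanSpace ℝ (Fin (k + 2))))
    (t : EuclideanSpace ℝ (Fin (k + 1))) : EuclideanSpace ℝ (Fin (k + 2)) :=
  ∑ j, t j • b j.succ

lemma inner_scaledCoords {k n : ℕ}
    (b : OrthonormalBasis (Fin (k + 2)) ℝ (EuclideanSpace ℝ (Fin (k + 2)))) (r : ℝ)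
    (x : Fin n → Sph (k + 2)) (t : EuclideanSpace ℝ (Fin (k + 1))) :
    inner ℝ (scaledCoords b r x) t = r * inner ℝ (sampleMean x) (liftDir b t) := by
  rw [liftDir, inner_sum, Finset.mul_sum, PiLp.inner_apply]
  refine Finset.sum_congr rfl fun j _ => ?_
  rw [inner_smul_right]
  simp [scaledCoords]
  ring

lemma inner_basis_zero_liftDir {k : ℕ}
    (b : OrthonormalBasis (Fin (k + 2)) ℝ (EuclideanSpace ℝ (Fin (k + 2))))
    (t : EuclideanSpace ℝ (Fin (k + 1))) : inner ℝ (b 0) (liftDir b t) = 0 := by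
  rw [liftDir, inner_sum]
  refine Finset.sum_eq_zero fun j _ => ?_
  rw [inner_smul_right, b.inner_eq_zero (Fin.succ_ne_zero j).symm, mul_zero]

lemma inner_basis_succ_liftDir {k : ℕ}
    (b : OrthonormalBasis (Fin (k + 2)) ℝ (EuclideanSpace ℝ (Fin (k + 2))))
    (t : EuclideanSpace ℝ (Fin (k + 1))) (i : Fin (k + 1)) :
    inner ℝ (b i.succ) (liftDir b t) = t i := by
  rw [liftDir, inner_sum, Finset.sum_eq_single i]
  · rw [inner_smul_right, b.inner_eq_one, mul_one]
  · intro j _ hj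
    rw [inner_smul_right, b.inner_eq_zero (fun h => hj (Fin.succ_injective _ h).symm), mul_zero]
  · simp

lemma norm_liftDir_sq {k : ℕ}
    (b : OrthonormalBasis (Fin (k + 2)) ℝ (EuclideanSpace ℝ (Fin (k + 2))))
    (t : EuclideanSpace ℝ (Fin (k + 1))) : ‖liftDir b t‖ ^ 2 = ‖t‖ ^ 2 := by
  rw [← b.sum_sq_norm_inner_right, Fin.sum_univ_succ, inner_basis_zero_liftDir,
    EuclideanSpace.norm_sq_eq]
  simp [inner_basis_succ_liftDir]

/-- An orthonormal basis adapted to two orthogonal directions. -/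
lemma exists_adapted_basis {k : ℕ} (θ₀ : Sph (k + 2)) {τ : EuclideanSpace ℝ (Fin (k + 2))}
    (hτ : inner ℝ (θ₀ : EuclideanSpace ℝ (Fin (k + 2))) τ = 0) :
    ∃ b : OrthonormalBasis (Fin (k + 2)) ℝ (EuclideanSpace ℝ (Fin (k + 2))),
      b 0 = θ₀ ∧ τ = ‖τ‖ • b (Fin.succ 0) := by
  have h10 : (Fin.succ 0 : Fin (k + 2)) ≠ 0 := Fin.succ_ne_zero 0
  -- Aligning the second basis vector with `τ` puts the whole limiting mean on one axis, as in
  -- `noncentralChiSq`. If `τ = 0` only `θ₀` is prescribed and any completion serves.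
  set v : Fin (k + 2) → EuclideanSpace ℝ (Fin (k + 2)) :=
    fun i => if i = 0 then (θ₀ : EuclideanSpace ℝ (Fin (k + 2))) else ‖τ‖⁻¹ • τ with hv
  have hv0 : v 0 = θ₀ := by simp [hv]
  have hv1 : v (Fin.succ 0) = ‖τ‖⁻¹ • τ := by simp only [hv, if_neg h10]
  by_cases h : τ = 0
  · obtain ⟨b, hb⟩ := Orthonormal.exists_orthonormalBasis_extension_of_card_eq (𝕜 := ℝ)
      (E := EuclideanSpace ℝ (Fin (k + 2))) (ι := Fin (k + 2)) (by simp)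
      (v := v) (s := {0}) (by
        constructor
        · rintro ⟨i, hi⟩
          rw [mem_singleton_iff] at hi
          subst hi
          simp [hv0]
        · rintro ⟨i, hi⟩ ⟨j, hj⟩ h
          simp only [mem_singleton_iff] at hi hj
          exact absurd (Subtype.ext (hi.trans hj.symm)) h)
    exact ⟨b, (hb 0 rfl).trans hv0, by simp [h]⟩
  · have hn : ‖τ‖ ≠ 0 := norm_ne_zero_iff.2 h
    have h01 : inner ℝ (v 0) (v (Fin.succ 0)) = 0 := by
      rw [hv0, hv1, inner_smul_right, hτ, mul_zero]
    obtain ⟨b, hb⟩ := Orthonormal.exists_orthonormalBasis_extension_of_card_eq (𝕜 := ℝ)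
      (E := EuclideanSpace ℝ (Fin (k + 2))) (ι := Fin (k + 2)) (by simp)
      (v := v) (s := {0, Fin.succ 0}) (by
        constructor
        · rintro ⟨i, hi⟩
          rcases hi with rfl | hi
          · simp [hv0]
          · rw [mem_singleton_iff] at hi
            subst hi
            rw [domRestrict_apply, hv1, norm_smul, norm_inv, norm_norm, inv_mul_cancel₀ hn]
        · rintro ⟨i, hi⟩ ⟨j, hj⟩ hij
          simp only [ne_eq, Subtype.mk.injEq] at hij
          simp only [domRestrict_apply]
          rcases hi with rfl | hi <;> rcases hj with rfl | hj
          · exact absurd rfl hij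
          · rw [mem_singleton_iff.1 hj, h01]
          · rw [mem_singleton_iff.1 hi, real_inner_comm, h01]
          · exact absurd (hi.trans hj.symm) hij)
    refine ⟨b, (hb 0 (by simp)).trans hv0, ?_⟩
    rw [hb (Fin.succ 0) (by simp), hv1, smul_smul, mul_inv_cancel₀ hn, one_smul]

/-- The Gaussian limit law, with mean `m` on the first axis. -/
noncomputable def limitGaussian (k : ℕ) (m : ℝ) : Measure (EuclideanSpace ℝ (Fin (k + 1))) :=
  (Measure.pi fun i : Fin (k + 1) => gaussianReal (if (i : ℕ) = 0 then m else 0) 1).map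
    (WithLp.toLp 2)

instance (k : ℕ) (m : ℝ) : IsProbabilityMeasure (limitGaussian k m) :=
  Measure.isProbabilityMeasure_map (Measurable.aemeasurable (by fun_prop))

lemma charFun_limitGaussian (k : ℕ) (m : ℝ) (t : EuclideanSpace ℝ (Fin (k + 1))) :
    charFun (limitGaussian k m) t
      = Complex.exp ((m * t 0 : ℝ) * Complex.I) * Complex.exp (-(‖t‖ ^ 2 / 2 : ℝ)) := by
  rw [limitGaussian, charFun_pi]
  simp_rw [charFun_gaussianReal]
  rw [← Complex.exp_sum, ← Complex.exp_add, EuclideanSpace.real_norm_sq_eq,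
    Finset.sum_sub_distrib]
  congr 1
  have : ∑ x : Fin (k + 1), (t x : ℂ) * ((if (x : ℕ) = 0 then m else 0 : ℝ) : ℂ) * Complex.I
      = (m * t 0 : ℝ) * Complex.I := by
    rw [Fin.sum_univ_succ]
    simp
    ring
  rw [this]
  push_cast
  rw [Finset.sum_div]
  simp [sub_eq_add_neg]

lemma map_norm_sq_limitGaussian (k : ℕ) {c : ℝ} :
    (limitGaussian k √c).map (fun y => ‖y‖ ^ 2) = noncentralChiSq (k + 1) c := by
  rw [limitGaussian, noncentralChiSq, Measure.map_map (by fun_prop) (by fun_prop)]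
  congr 1
  ext z
  simp [EuclideanSpace.real_norm_sq_eq]

end HighConc

-- Limit laws of the two statistics

namespace HighConc

/-- Convergence in distribution sees the limit variable only through its law, so it may be replaced
by the identity under that law. -/
lemma tendstoInDistribution_id_of_map_eq {Ω : ℕ → Type*} [∀ n, MeasurableSpace (Ω n)]
    {P : ∀ n, Measure (Ω n)} [∀ n, IsProbabilityMeasure (P n)] {Ω' : Type*} [MeasurableSpace Ω']
    {μ : Measure Ω'} [IsProbabilityMeasure μ] {X : ∀ n, Ω n → ℝ} {Z : Ω' → ℝ}
    (h : TendstoInDistribution X atTop Z P μ) {ν : Measure ℝ} [IsProbabilityMeasure ν]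
    (hν : μ.map Z = ν) : TendstoInDistribution X atTop id P ν where
  forall_aemeasurable := h.forall_aemeasurable
  aemeasurable_limit := aemeasurable_id
  tendsto := by
    subst hν
    have e : (⟨(μ.map Z).map id, Measure.isProbabilityMeasure_map aemeasurable_id⟩ :
        ProbabilityMeasure ℝ) = ⟨μ.map Z, Measure.isProbabilityMeasure_map h.aemeasurable_limit⟩ :=
      Subtype.ext Measure.map_id
    rw [e]
    exact h.tendsto

namespace LocalSequence

variable {k : ℕ} {f : ℝ → ℝ} {κ : ℕ → ℝ} {τ : ℕ → EuclideanSpace ℝ (Fin (k + 2))}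
  {τlim : EuclideanSpace ℝ (Fin (k + 2))} {θ₀ : Sph (k + 2)} {θ : ℕ → Sph (k + 2)}

/-- Since `θ₀` and `θ n` are both unit vectors, `2 θ₀'τ_n + ν_n ‖τ_n‖² = 0` whenever `ν_n ≠ 0`; pass
to the limit. -/
lemma inner_lim_eq_zero (h : LocalSequence f κ τ τlim θ₀ θ) :
    inner ℝ (θ₀ : EuclideanSpace ℝ (Fin (k + 2))) τlim = 0 := by
  have h1 : Tendsto (fun n => inner ℝ (θ₀ : EuclideanSpace ℝ (Fin (k + 2))) (τ n)) atTop
      (𝓝 (inner ℝ (θ₀ : EuclideanSpace ℝ (Fin (k + 2))) τlim)) :=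
    tendsto_const_nhds.inner h.tendsto_dir
  have h2 := (h.tendsto_rate.mul (h.tendsto_dir.norm.pow 2)).const_mul (-(1 / 2))
  rw [zero_mul, mul_zero] at h2
  refine tendsto_nhds_unique h1 (h2.congr' ?_)
  filter_upwards [h.eventually_sqrt_mul_rate] with n hn
  have hr : rate f κ n ≠ 0 := right_ne_zero_of_mul (hn ▸ one_ne_zero)
  have e := norm_add_sq_real (θ₀ : EuclideanSpace ℝ (Fin (k + 2))) (rate f κ n • τ n)
  rw [← h.loc_eq n, norm_eq_of_mem_sphere, norm_eq_of_mem_sphere, inner_smul_right, norm_smul,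
    mul_pow, Real.norm_eq_abs, sq_abs] at e
  refine mul_left_cancel₀ hr ?_
  linarith

variable {Ω : ℕ → Type*} [∀ n, MeasurableSpace (Ω n)] {P : ∀ n, Measure (Ω n)}
  [∀ n, IsProbabilityMeasure (P n)] {X : ∀ n, Fin n → Ω n → Sph (k + 2)}

lemma convProb_testDenom (h : LocalSequence f κ τ τlim θ₀ θ)
    (hX : ∀ n, IsRotSample (P n) (X n) (θ n) (κ n) f) :
    ConvProb P (fun n ω => conc f κ n * testDenom θ₀ (fun i => X n i ω)) ((k : ℝ) + 1) := by
  refine convProb_of_variance (fun n => ?_) ?_ ?_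
  · exact (hX n).memLp_comp (G := fun x => conc f κ n * testDenom θ₀ x) (by fun_prop) 2
  · refine h.tendsto_conc_mul_integral_denom.congr' ?_
    filter_upwards [eventually_ne_atTop 0] with n hn
    rw [integral_const_mul, (hX n).integral_testDenom hn]
  · refine squeeze_zero' (Eventually.of_forall fun n => variance_nonneg _ _) ?_
      h.tendsto_denom_second_moment
    filter_upwards [eventually_ne_atTop 0] with n hn
    rw [variance_const_mul]
    refine (mul_le_mul_of_nonneg_left ((hX n).variance_testDenom_le hn θ₀)
      (sq_nonneg _)).trans (le_of_eq ?_)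
    ring

lemma convProb_sampleMean (h : LocalSequence f κ τ τlim θ₀ θ)
    (hX : ∀ n, IsRotSample (P n) (X n) (θ n) (κ n) f) :
    ConvProb P (fun n ω => sampleMean fun i => X n i ω)
      (θ₀ : EuclideanSpace ℝ (Fin (k + 2))) := by
  refine convProb_of_integral_dist (fun n => ?_) ?_
  · exact ((hX n).memLp_comp (G := fun x => dist (sampleMean x)
      (θ₀ : EuclideanSpace ℝ (Fin (k + 2)))) (by fun_prop) 1).integrable le_rfl
  · have h1 := h.tendsto_integral_norm_sub.add
      (h.tendsto_loc.sub_const (θ₀ : EuclideanSpace ℝ (Fin (k + 2)))).norm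
    rw [sub_self, norm_zero, add_zero] at h1
    refine squeeze_zero' (Eventually.of_forall fun n => integral_nonneg fun ω => dist_nonneg) ?_ h1
    filter_upwards [eventually_ne_atTop 0] with n hn
    exact (hX n).integral_dist_sampleMean_le hn _

/-- Asymptotic normality of the tangential part of the sample mean. -/
lemma tendstoInDistribution_scaledCoords (h : LocalSequence f κ τ τlim θ₀ θ)
    (hX : ∀ n, IsRotSample (P n) (X n) (θ n) (κ n) f)
    {b : OrthonormalBasis (Fin (k + 2)) ℝ (EuclideanSpace ℝ (Fin (k + 2)))} (hb : b 0 = θ₀)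
    (hb1 : τlim = ‖τlim‖ • b (Fin.succ 0)) :
    TendstoInDistribution
      (fun n ω => scaledCoords b √(n * conc f κ n) (fun i => X n i ω)) atTop id P
      (limitGaussian k ‖τlim‖) where
  forall_aemeasurable n :=
    (continuous_scaledCoords b _).measurable.comp_aemeasurable (hX n).aemeasurable_pi
  aemeasurable_limit := aemeasurable_id
  tendsto := by
    refine ProbabilityMeasure.tendsto_iff_tendsto_charFun.2 fun t => ?_
    simp only [ProbabilityMeasure.coe_mk, Measure.map_id]
    rw [charFun_limitGaussian]
    set w := liftDir b t with hwdef
    have hw : inner ℝ (θ₀ : EuclideanSpace ℝ (Fin (k + 2))) w = 0 := by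
      rw [← hb]; exact inner_basis_zero_liftDir b t
    have hτw : inner ℝ τlim w = ‖τlim‖ * t 0 := by
      nth_rewrite 1 [hb1]
      rw [real_inner_smul_left, hwdef, inner_basis_succ_liftDir]
    have h1 : Tendsto (fun n => Complex.exp ((inner ℝ (τ n) w : ℝ) * Complex.I)) atTop
        (𝓝 (Complex.exp ((inner ℝ τlim w : ℝ) * Complex.I))) := by
      have hc : Continuous fun y : ℝ => Complex.exp ((y : ℂ) * Complex.I) := by fun_prop
      exact (hc.tendsto _).comp (h.tendsto_dir.inner tendsto_const_nhds)
    have h2 := h1.mul (h.tendsto_integral_exp_pow hw)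
    rw [hτw, norm_liftDir_sq] at h2
    refine h2.congr' ?_
    filter_upwards [h.eventually_sqrt_mul_inner hw, h.tendsto_conc.eventually_gt_atTop 0,
      eventually_gt_atTop 0] with n hn ha hn0
    have hn' : (0 : ℝ) < n := Nat.cast_pos.2 hn0
    have e1 : √(n * conc f κ n) = √(conc f κ n / n) * n := by
      rw [show (n : ℝ) * conc f κ n = (conc f κ n / n) * n ^ 2 by field_simp,
        Real.sqrt_mul (by positivity), Real.sqrt_sq hn'.le]
    -- Each linear form of the rescaled mean is the deterministic drift `τ_n'w` plus a sum of
    -- independent identically distributed terms, to which the central limit theorem applies.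
    have e2 : ∀ ω, inner ℝ (scaledCoords b √(n * conc f κ n) (fun i => X n i ω)) t
        = inner ℝ (τ n) w + ∑ i, √(conc f κ n / n) *
          inner ℝ ((X n i ω : EuclideanSpace ℝ (Fin (k + 2))) - θ n) w := by
      intro ω
      rw [inner_scaledCoords, ← hwdef, ← hn, ← Finset.mul_sum, ← sum_inner,
        Finset.sum_sub_distrib, inner_sub_left, sampleMean, real_inner_smul_left, e1]
      simp only [Finset.sum_const, Finset.card_univ, Fintype.card_fin,
        ← Nat.cast_smul_eq_nsmul ℝ, real_inner_smul_left]
      field_simp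
      ring
    have hm : AEMeasurable (fun ω => scaledCoords b √(n * conc f κ n) fun i => X n i ω) (P n) :=
      (continuous_scaledCoords b _).measurable.comp_aemeasurable (hX n).aemeasurable_pi
    rw [charFun_apply, integral_map hm (Continuous.aestronglyMeasurable (by fun_prop))]
    simp_rw [e2]
    rw [← (hX n).integral_exp_sum (g := fun x => √(conc f κ n / n) *
      inner ℝ ((x : EuclideanSpace ℝ (Fin (k + 2))) - θ n) w) (by fun_prop),
      ← integral_const_mul]
    refine integral_congr_ae (ae_of_all _ fun ω => ?_)
    simp only
    rw [← Complex.exp_add]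
    congr 1
    push_cast
    ring

/-- The unknown concentration `a` enters numerator and denominator alike, which makes both factors
converge. -/
lemma watson_eq {n : ℕ} (x : Fin n → Sph (k + 2)) {a : ℝ} (ha : 0 < a) (hn : n ≠ 0)
    {b : OrthonormalBasis (Fin (k + 2)) ℝ (EuclideanSpace ℝ (Fin (k + 2)))} (hb : b 0 = θ₀) :
    watson θ₀ x = ((k : ℝ) + 1) / (a * testDenom θ₀ x) * ‖scaledCoords b √(n * a) x‖ ^ 2 := by
  have hn' : (0 : ℝ) < n := Nat.cast_pos.2 (Nat.pos_of_ne_zero hn)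
  rw [watson, norm_scaledCoords_sq b _ θ₀ hb, Real.sq_sqrt (by positivity)]
  push_cast
  rw [← div_div]
  field_simp
  ring

/-- The tangential form is quadratic, so normalizing the mean pulls out `‖x̄‖⁻²`. The identity also
holds when `x̄ = 0`, both sides then being zero. -/
lemma wald_eq {n : ℕ} (x : Fin n → Sph (k + 2)) :
    wald θ₀ x = watson θ₀ x * (inner ℝ (sampleMean x)
      (θ₀ : EuclideanSpace ℝ (Fin (k + 2))) ^ 2 * ‖sampleMean x‖⁻¹ ^ 2) := by
  have e : tangentForm θ₀ (sphericalMean x)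
      = ‖sampleMean x‖⁻¹ ^ 2 * tangentForm θ₀ (sampleMean x) := by
    rw [tangentForm_eq, tangentForm_eq, sphericalMean, norm_smul, inner_smul_right, norm_inv,
      norm_norm]
    ring
  rw [wald, watson, e]
  ring

/-- The limiting behaviour of the Watson and Wald statistics along a local sequence. -/
lemma watson_wald (h : LocalSequence f κ τ τlim θ₀ θ)
    (hX : ∀ n, IsRotSample (P n) (X n) (θ n) (κ n) f) :
    (∀ ε : ℝ, 0 < ε → Tendsto (fun n => P n {ω | ε ≤
          |watson θ₀ (fun i => X n i ω) - wald θ₀ (fun i => X n i ω)|}) atTop (𝓝 0)) ∧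
      TendstoInDistribution (fun n ω => watson θ₀ (fun i => X n i ω)) atTop
        id P (noncentralChiSq (k + 1) (‖τlim‖ ^ 2)) ∧
      TendstoInDistribution (fun n ω => wald θ₀ (fun i => X n i ω)) atTop
        id P (noncentralChiSq (k + 1) (‖τlim‖ ^ 2)) := by
  obtain ⟨b, hb, hb1⟩ := exists_adapted_basis θ₀ h.inner_lim_eq_zero
  have hk : (k : ℝ) + 1 ≠ 0 := by positivity
  set U : ∀ n, Ω n → ℝ := fun n ω =>
    ‖scaledCoords b √(n * conc f κ n) (fun i => X n i ω)‖ ^ 2 with hU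
  have hUd : TendstoInDistribution U atTop id P (noncentralChiSq (k + 1) (‖τlim‖ ^ 2)) := by
    have h1 := (h.tendstoInDistribution_scaledCoords hX hb hb1).continuous_comp
      (g := fun y => ‖y‖ ^ 2) (by fun_prop)
    refine tendstoInDistribution_id_of_map_eq h1 ?_
    rw [← map_norm_sq_limitGaussian, Real.sqrt_sq (norm_nonneg _)]
    rfl
  set A : ∀ n, Ω n → ℝ := fun n ω =>
    ((k : ℝ) + 1) / (conc f κ n * testDenom θ₀ (fun i => X n i ω)) with hA
  set R : ∀ n, Ω n → ℝ := fun n ω => inner ℝ (sampleMean fun i => X n i ω)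
      (θ₀ : EuclideanSpace ℝ (Fin (k + 2))) ^ 2 * ‖sampleMean fun i => X n i ω‖⁻¹ ^ 2 with hR
  have hA1 : ConvProb P A 1 := by
    have := (h.convProb_testDenom hX).comp (g := fun y => ((k : ℝ) + 1) / y)
      (continuousAt_const.div continuousAt_id hk)
    rwa [div_self hk] at this
  have hR1 : ConvProb P R 1 := by
    have hθ₀ : ‖(θ₀ : EuclideanSpace ℝ (Fin (k + 2)))‖ = 1 := norm_eq_of_mem_sphere θ₀
    have := (h.convProb_sampleMean hX).comp (g := fun y => inner ℝ y
      (θ₀ : EuclideanSpace ℝ (Fin (k + 2))) ^ 2 * ‖y‖⁻¹ ^ 2)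
      (ContinuousAt.mul (by fun_prop) ((continuousAt_id.norm.inv₀ (by simp)).pow 2))
    rwa [real_inner_self_eq_norm_sq, hθ₀, inv_one, one_pow, one_pow, one_mul] at this
  have hAR := hA1.prodMk hR1
  have hW : ∀ᶠ n in atTop, ∀ ω, watson θ₀ (fun i => X n i ω) = A n ω * U n ω := by
    filter_upwards [h.tendsto_conc.eventually_gt_atTop 0, eventually_ne_atTop 0] with n ha hn ω
    exact watson_eq _ ha hn hb
  -- Eventually the Watson statistic is `A U` and the Wald statistic `A R U`. Their difference is
  -- `(A - A R) U`, and their distances to `U` are `(A - 1) U` and `(A R - 1) U`; each coefficient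
  -- tends to zero and `U` converges in distribution.
  have hg1 : ConvProb P (fun n ω => A n ω - A n ω * R n ω) 0 := by
    have := hAR.comp (g := fun q : ℝ × ℝ => q.1 - q.1 * q.2) (by fun_prop)
    simpa using this
  have hg2 : ConvProb P (fun n ω => A n ω - 1) 0 := by
    have := hA1.comp (g := fun q : ℝ => q - 1) (by fun_prop)
    simpa using this
  have hg3 : ConvProb P (fun n ω => A n ω * R n ω - 1) 0 := by
    have := hAR.comp (g := fun q : ℝ × ℝ => q.1 * q.2 - 1) (by fun_prop)
    simpa using this
  refine ⟨fun ε hε => ?_, ?_, ?_⟩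
  · have hd : ConvProb P (fun n ω => watson θ₀ (fun i => X n i ω) - wald θ₀ (fun i => X n i ω)) 0 :=
      (hg1.mul_of_tendstoInDistribution hUd).congr (by
        filter_upwards [hW] with n hn ω
        rw [wald_eq, hn ω]
        ring)
    simpa [dist_zero_right] using hd ε hε
  · refine tendstoInDistribution_of_convProb_sub hUd
      ((hg2.mul_of_tendstoInDistribution hUd).congr (by
        filter_upwards [hW] with n hn ω
        rw [hn ω]
        ring)) fun n => (measurable_watson θ₀).comp_aemeasurable (hX n).aemeasurable_pi
  · refine tendstoInDistribution_of_convProb_sub hUd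
      ((hg3.mul_of_tendstoInDistribution hUd).congr (by
        filter_upwards [hW] with n hn ω
        rw [wald_eq, hn ω]
        ring)) fun n => (measurable_wald θ₀).comp_aemeasurable (hX n).aemeasurable_pi

lemma of_isRotSample (hf : AngularClass f) (hκ : Tendsto κ atTop atTop)
    (hτ : Tendsto τ atTop (𝓝 τlim))
    (hθ : ∀ n, (θ n : EuclideanSpace ℝ (Fin (k + 2))) = θ₀ + rate f κ n • τ n)
    (hX : ∀ n, IsRotSample (P n) (X n) (θ n) (κ n) f) : LocalSequence f κ τ τlim θ₀ θ where
  angular := hf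
  tendsto_kappa := hκ
  tendsto_dir := hτ
  loc_eq := hθ
  prob := by
    -- For `n ≥ 1` the common law is that of an actual observation, hence a probability measure; for
    -- `n = 0` there is none.
    filter_upwards [eventually_gt_atTop 0] with n hn
    exact ((hX n).hasLaw ⟨0, hn⟩).isProbabilityMeasure_iff.1 inferInstance

end LocalSequence

lemma noncentralChiSq_zero (k : ℕ) : noncentralChiSq k 0 = chiSq k := by
  simp [noncentralChiSq, chiSq]

end HighConc

theorem theorem6 (p : ℕ) (hp : 2 ≤ p) (θ₀ : HighConc.Sph p)
    (f : ℝ → ℝ) (hf : HighConc.AngularClass f)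
    (κ : ℕ → ℝ) (hκ_pos : ∀ n, 0 < κ n) (hκ : Tendsto κ atTop atTop)
    (τ : ℕ → EuclideanSpace ℝ (Fin p)) (τlim : EuclideanSpace ℝ (Fin p))
    (hτ : Tendsto τ atTop (𝓝 τlim))
    (θ : ℕ → HighConc.Sph p)
    (hθ : ∀ n, (θ n : EuclideanSpace ℝ (Fin p))
      = (θ₀ : EuclideanSpace ℝ (Fin p)) + HighConc.rate f κ n • τ n) :
    -- (i) under the sequence of null hypotheses
    (∀ (Ω : ℕ → Type*) [∀ n, MeasurableSpace (Ω n)] (P : ∀ n, Measure (Ω n))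
        [∀ n, IsProbabilityMeasure (P n)] (X : ∀ n, Fin n → Ω n → HighConc.Sph p),
        (∀ n, HighConc.IsRotSample (P n) (X n) θ₀ (κ n) f) →
      (∀ ε : ℝ, 0 < ε → Tendsto (fun n => P n {ω | ε ≤
          |HighConc.watson θ₀ (fun i => X n i ω) - HighConc.wald θ₀ (fun i => X n i ω)|})
        atTop (𝓝 0)) ∧
      TendstoInDistribution (fun n ω => HighConc.watson θ₀ (fun i => X n i ω)) atTop
        id P (HighConc.chiSq (p - 1)) ∧
      TendstoInDistribution (fun n ω => HighConc.wald θ₀ (fun i => X n i ω)) atTop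
        id P (HighConc.chiSq (p - 1))) ∧
    -- (ii) under the sequence of local alternatives
    (∀ (Ω : ℕ → Type*) [∀ n, MeasurableSpace (Ω n)] (P : ∀ n, Measure (Ω n))
        [∀ n, IsProbabilityMeasure (P n)] (X : ∀ n, Fin n → Ω n → HighConc.Sph p),
        (∀ n, HighConc.IsRotSample (P n) (X n) (θ n) (κ n) f) →
      (∀ ε : ℝ, 0 < ε → Tendsto (fun n => P n {ω | ε ≤
          |HighConc.watson θ₀ (fun i => X n i ω) - HighConc.wald θ₀ (fun i => X n i ω)|})
        atTop (𝓝 0)) ∧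
      TendstoInDistribution (fun n ω => HighConc.watson θ₀ (fun i => X n i ω)) atTop
        id P (HighConc.noncentralChiSq (p - 1) (‖τlim‖ ^ 2)) ∧
      TendstoInDistribution (fun n ω => HighConc.wald θ₀ (fun i => X n i ω)) atTop
        id P (HighConc.noncentralChiSq (p - 1) (‖τlim‖ ^ 2))) := by
  obtain ⟨k, rfl⟩ := Nat.exists_eq_add_of_le' hp
  refine ⟨fun Ω _ P _ X hX => ?_, fun Ω _ P _ X hX => ?_⟩
  -- The null hypothesis is the local sequence with zero directions.
  · have h : HighConc.LocalSequence f κ (fun _ => 0) 0 θ₀ (fun _ => θ₀) :=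
      .of_isRotSample hf hκ tendsto_const_nhds (by simp) hX
    have key := h.watson_wald hX
    rw [norm_zero, zero_pow two_ne_zero] at key
    simp only [HighConc.noncentralChiSq_zero] at key
    exact key
  · exact (HighConc.LocalSequence.of_isRotSample hf hκ hτ hθ hX).watson_wald hX
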